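/- **Definitions.** A real symmetric matrix $A=(a_{ij})$ with all $a_{ii}=-2$ is *fundamental* if for all $i\ne j$ one has $a_{ij}\ge 0$ and, if $a_{ij}<2$, then $a_{ij}=2\cos(\pi/m_{ij})$ with an integer $m_{ij}\ge 2$. Its cyclic products are $a_{i_1i_2}a_{i_2i_3}\cdots a_{i_{m-1}i_m}a_{i_mi_1}$; the field $\mathbb K\subset\mathbb R$ generated over $\mathbb Q$ by all of them is the *ground field* of $A$. The matrix $A$ (or the corresponding graph, whose vertices are the indices, two of them being joined if $a_{ij}\neq 0$) is *V-arithmetic* if it is fundamental; the form $\sum a_{ij}X_iY_j$ modulo its kernel is hyperbolic (of signature $(1,n)$); all cyclic products are algebraic integers; the field $\widetilde{\mathbb K}=\mathbb Q(\{a_{ij}\})$ is totally real; and for every embedding $\sigma:\widetilde{\mathbb K}\to\mathbb R$ that is not the identity on $\mathbb K$ the form $\sum\sigma(a_{ij})X_iY_j$ modulo its kernel is negative definite. It has *minimality* $t$ if all $a_{ij}<t$. It is a *finite edge* matrix with distinguished indices $e_1\ne e_2$ if it is fundamental and hyperbolic and becomes negative definite when $e_1$ is deleted and when $e_2$ is deleted.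 For an integer $d\ge 3$ and real $u>2$ let $\Gamma_2^{(3)}$ be the graph (with distinguished vertices $e_1,e_2$, the first two) with Gram matrix $$\begin{pmatrix}-2&u&0\\u&-2&2\cos\frac{\pi}{d}\\0&2\cos\frac{\pi}{d}&-2\end{pmatrix},$$ and put $\mathbb F_d=\mathbb Q(\cos^2(\pi/d))$. **Theorem.** (1) Let $d\ge 3$ be an integer, let $u>0$ be real and put $\alpha=u^2$. Then $u>2$ and $\Gamma_2^{(3)}$ with the parameters $d,u$ is a V-arithmetic connected finite edge graph of minimality $14$ (so that $2<u<14$) if and only if $\alpha$ is a totally real algebraic integer with $4<\alpha<14^2$ and $$0<\sigma(\alpha)<\sigma\left(4\sin^2\tfrac{\pi}{d}\right)$$ for every embedding $\sigma:\mathbb Q(\alpha,\cos^2(\pi/d))\to\mathbb R$ different from the identity. (2) If $\Gamma_2^{(3)}$ with the parameters $d\ge 3$, $u>2$ is a V-arithmetic connected finite edge graph of minimality $14$, with ground field $\mathbb K$, then $\mathbb F_d\subset\mathbb K=\mathbb Q(u^2)$, the degree $[\mathbb K:\mathbb Q]$ is finite, and for $m=[\mathbb K:\mathbb F_d]$ one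 of the following holds: $d=3$, $m\le 44$; $d=4$, $m\le 16$; $d=5$, $m\le 10$; $d=6$, $m\le 8$; $d=7$, $m\le 9$; $d=8$, $m\le 8$; $d=9$, $m\le 5$; $d=10$, $m\le 5$; $d=11$, $m\le 4$; $d=12$, $m\le 5$; $d=13$, $m\le 3$; $d=14$, $m\le 3$; $d=15$, $m\le 2$; $d=16$, $m\le 3$; $d=17$, $m\le 2$; $d=18$, $m\le 3$; $d=20$, $m\le 2$; $d=21$, $m\le 2$; $d=22$, $m\le 2$; $d=24$, $m\le 3$; $d=26$, $m\le 2$; $d=28$, $m\le 2$; $d=30$, $m\le 3$; $d=36$, $m\le 2$; $d=42$, $m\le 2$; or $m=1$, $\mathbb K=\mathbb F_d$ and $d$ is one of $19$, $23$, $25$, $27$, $29$, $31$, $32$, $33$, $34$, $35$, $38$, $39$, $40$, $44$, $45$, $46$, $48$, $50$, $52$, $54$, $56$, $58$, $60$, $66$, $70$, $72$, $78$, $84$, $90$, $102$, $120$. In particular, $[\mathbb K:\mathbb Q]\le 44$ for $d=3$; $[\mathbb K:\mathbb Q]\le 27$ for $d=7$; $[\mathbb K:\mathbb Q]\le 20$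 for $d=5,11$; $[\mathbb K:\mathbb Q]\le 18$ for $d=13$; and $[\mathbb K:\mathbb Q]\le 16$ for all other $d$. (3) The set of all the ground fields $\mathbb K$ occurring in (2) is finite, and their degrees over $\mathbb Q$ are at most $44$. -/

import Mathlib

open scoped IntermediateField

noncomputable section

namespace EdgeGraph

/-- A real matrix is fundamental: it is symmetric, its diagonal entries are `-2`, its off-diagonal
entries are nonnegative, and those smaller than `2` have the form `2 cos (π / m)` with an
integer `m ≥ 2`. -/
structure IsFundamental {ι : Type*} (A : Matrix ι ι ℝ) : Prop where
  symm : A.IsSymm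
  diag : ∀ i, A i i = -2
  nonneg : ∀ i j, i ≠ j → 0 ≤ A i j
  angle : ∀ i j, i ≠ j → A i j < 2 → ∃ m : ℕ, 2 ≤ m ∧ A i j = 2 * Real.cos (Real.pi / m)

/-- The symmetric form with matrix `A`, taken modulo its kernel, is hyperbolic, i.e. of signature
`(1, n)`: its positive index of inertia is `1`. -/
def IsHyperbolic {ι : Type*} [Fintype ι] [DecidableEq ι] (A : Matrix ι ι ℝ) : Prop :=
  sigPos (Matrix.toQuadraticForm' A) = 1

/-- The symmetric form with matrix `A`, taken modulo its kernel, is negative definite. -/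
def IsNegDefModKernel {ι : Type*} [Fintype ι] (A : Matrix ι ι ℝ) : Prop :=
  ∀ x : ι → ℝ, A.mulVec x ≠ 0 → x ⬝ᵥ A.mulVec x < 0

/-- `b` is a cyclic product `a_{i₁ i₂} a_{i₂ i₃} ⋯ a_{i_m i₁}`, `m ≥ 1`, of entries of `A`
(here `m = n + 1`, and `j + 1` is taken cyclically in `Fin (n + 1)`). -/
def IsCyclicProduct {ι : Type*} (A : Matrix ι ι ℝ) (b : ℝ) : Prop :=
  ∃ (n : ℕ) (i : Fin (n + 1) → ι), b = ∏ j, A (i j) (i (j + 1))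

/-- The ground field: the subfield of `ℝ` generated by all cyclic products of `A`. -/
def groundField {ι : Type*} (A : Matrix ι ι ℝ) : IntermediateField ℚ ℝ :=
  IntermediateField.adjoin ℚ {b | IsCyclicProduct A b}

/-- The subfield of `ℝ` generated by all entries of `A`. -/
def entryField {ι : Type*} (A : Matrix ι ι ℝ) : IntermediateField ℚ ℝ :=
  IntermediateField.adjoin ℚ {a | ∃ i j, a = A i j}

/-- The matrix `A` with its entries viewed in the field they generate. -/
def entryMatrix {ι : Type*} (A : Matrix ι ι ℝ) : Matrix ι ι (entryField A) :=
  fun i j => ⟨A i j, IntermediateField.subset_adjoin ℚ _ ⟨i, j, rfl⟩⟩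

/-- V-arithmetic matrices: fundamental matrices with a hyperbolic form that satisfy Vinberg's
arithmeticity conditions. -/
structure IsVArithmetic {ι : Type*} [Fintype ι] [DecidableEq ι] (A : Matrix ι ι ℝ) : Prop where
  fundamental : IsFundamental A
  hyperbolic : IsHyperbolic A
  integral : ∀ b, IsCyclicProduct A b → IsIntegral ℤ b
  totallyReal : NumberField.IsTotallyReal (entryField A)
  negDef : ∀ σ : entryField A →+* ℝ,
    (∃ x : entryField A, (x : ℝ) ∈ groundField A ∧ σ x ≠ (x : ℝ)) →
      IsNegDefModKernel ((entryMatrix A).map σ)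

/-- The Gram graph: distinct vertices are joined (by a thin, thick or broken edge) if and only if
the corresponding entry is nonzero. -/
def gramGraph {ι : Type*} (A : Matrix ι ι ℝ) : SimpleGraph ι :=
  SimpleGraph.fromRel fun i j => A i j ≠ 0

/-- Finite edge matrices: all faces pass through one of the two finite vertices of an edge; `e₁`
is the only face not passing through the second vertex, `e₂` the only face not passing through
the first one. In terms of Gram matrices: `A` is hyperbolic, and it becomes negative definite when
`e₁`, or `e₂`, is deleted. -/
structure IsFiniteEdge {ι : Type*} [Fintype ι] [DecidableEq ι] (A : Matrix ι ι ℝ)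
    (e₁ e₂ : ι) : Prop where
  ne : e₁ ≠ e₂
  fundamental : IsFundamental A
  hyperbolic : IsHyperbolic A
  negDef₁ : (-(A.submatrix (fun i : {i // i ≠ e₁} => i.1) (fun i => i.1))).PosDef
  negDef₂ : (-(A.submatrix (fun i : {i // i ≠ e₂} => i.1) (fun i => i.1))).PosDef

/-- All entries are smaller than `t`. -/
def HasMinimality {ι : Type*} (A : Matrix ι ι ℝ) (t : ℝ) : Prop :=
  ∀ i j, A i j < t

/-- The Gram matrix of the graph `Γ₂⁽³⁾` with parameter `d`, where `u = e₁ · e₂`; the vertices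
`e₁`, `e₂` have the indices `0`, `1`. -/
def gramΓ₂ (d : ℕ) (u : ℝ) : Matrix (Fin 3) (Fin 3) ℝ :=
  !![-2, u, 0;
     u, -2, 2 * Real.cos (Real.pi / d);
     0, 2 * Real.cos (Real.pi / d), -2]

/-- `Γ₂⁽³⁾` with parameters `d ≥ 3` and `u > 2` (broken edge) is a V-arithmetic connected finite
edge graph of minimality `t`. -/
structure IsΓ₂ (t : ℝ) (d : ℕ) (u : ℝ) : Prop where
  three_le : 3 ≤ d
  two_lt : 2 < u
  minimality : HasMinimality (gramΓ₂ d u) t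
  connected : (gramGraph (gramΓ₂ d u)).Connected
  edge : IsFiniteEdge (gramΓ₂ d u) 0 1
  arithmetic : IsVArithmetic (gramΓ₂ d u)

/-- The field `𝔽_d = ℚ(cos² (π / d))`. -/
def cosField (d : ℕ) : IntermediateField ℚ ℝ :=
  ℚ⟮Real.cos (Real.pi / d) ^ 2⟯

/-- The field `ℚ(α, cos² (π / d))`. -/
def fieldOf (d : ℕ) (α : ℝ) : IntermediateField ℚ ℝ :=
  IntermediateField.adjoin ℚ {α, Real.cos (Real.pi / d) ^ 2}

theorem mem_fieldOf (d : ℕ) (α : ℝ) : α ∈ fieldOf d α :=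
  IntermediateField.subset_adjoin ℚ _ (by simp)

theorem four_sin_sq_mem_fieldOf (d : ℕ) (α : ℝ) :
    4 * Real.sin (Real.pi / d) ^ 2 ∈ fieldOf d α := by
  have h : Real.cos (Real.pi / d) ^ 2 ∈ fieldOf d α :=
    IntermediateField.subset_adjoin ℚ _ (by simp)
  have h4 : (4 : ℝ) ∈ fieldOf d α := ofNat_mem _ 4
  rw [Real.sin_sq]
  exact mul_mem h4 (sub_mem (one_mem _) h)

/-- `α` is a totally real algebraic integer such that, for `𝕂 = ℚ(α, cos² (π / d))`, one has
`0 < σ α < σ (4 sin² (π / d))` for all embeddings `σ : 𝕂 → ℝ` different from the identity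
embedding, and `4 < α < t²`. -/
structure IsAdmissible (t : ℝ) (d : ℕ) (α : ℝ) : Prop where
  integral : IsIntegral ℤ α
  totallyReal : NumberField.IsTotallyReal ℚ⟮α⟯
  conj : ∀ σ : fieldOf d α →+* ℝ, (∃ x : fieldOf d α, σ x ≠ (x : ℝ)) →
    0 < σ ⟨α, mem_fieldOf d α⟩ ∧
      σ ⟨α, mem_fieldOf d α⟩ <
        σ ⟨4 * Real.sin (Real.pi / d) ^ 2, four_sin_sq_mem_fieldOf d α⟩
  lower : 4 < α
  upper : α < t ^ 2

/-- The pairs `(d, b)` for which the bound `[𝕂 : 𝔽_d] ≤ b` is claimed with the given `b ≥ 2`. -/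
def boundTable : List (ℕ × ℕ) :=
  [(3, 44), (4, 16), (5, 10), (6, 8), (7, 9), (8, 8), (9, 5), (10, 5), (11, 4), (12, 5),
   (13, 3), (14, 3), (15, 2), (16, 3), (17, 2), (18, 3), (20, 2), (21, 2), (22, 2), (24, 3),
   (26, 2), (28, 2), (30, 3), (36, 2), (42, 2)]

/-- The remaining possible `d`, for which `𝕂 = 𝔽_d` is claimed. -/
def remainingList : List ℕ :=
  [19, 23, 25, 27, 29, 31, 32, 33, 34, 35, 38, 39, 40, 44, 45, 46, 48, 50, 52, 54, 56, 58, 60,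
   66, 70, 72, 78, 84, 90, 102, 120]

/-- The set `𝓕Γ₂⁽³⁾(t)` of ground fields of V-arithmetic graphs `Γ₂⁽³⁾` of minimality `t`. -/
def groundFieldsΓ₂ (t : ℝ) : Set (IntermediateField ℚ ℝ) :=
  {K | ∃ d u, IsΓ₂ t d u ∧ K = groundField (gramΓ₂ d u)}

end EdgeGraph

end

namespace EdgeGraph

open NumberField Polynomial

/-! Write `α = u²` and `s = 4 sin²(π/d)`. Completing squares, the form of the matrix with
off-diagonal entries `a`, `b`, `0` is negative definite as soon as `a² + b² < 4`, and negative
definiteness modulo the kernel forces `a² + b² ≤ 4`. With `a = σ(u)` and `b = σ(2 cos(π/d))`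
Vinberg's condition becomes `σ(α) < σ(s)`, where equality is impossible because `s < 4 < α` and `σ`
is injective. Diagonal rescaling shows that the ground field is `ℚ(α, cos²(π/d))`. It equals `ℚ(α)`,
since every embedding other than the identity sends `α` below `4` and so none of them fixes `α`.

The degree bounds use auxiliary polynomials. For an integral polynomial `P` let `β = P(α, s)`, a
nonzero algebraic integer, so that `|N β| ≥ 1`. If `w` depends on `s` alone and `|σ β| ≤ |σ w|` for
all `σ` but the identity, then `|w| ≤ |β| · |N w|` (`abs_le_abs_mul_norm`). Here `|β|` is bounded
because `4 < α < 196`. The norm of `w` is explicit: `w` is a rational constant times powers of `s`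
and, for `d = 5, 7`, of the unit `s - 2`, while the norm of `s` from `𝔽_d` is `Φ_d(1)` up to sign
(`cosField_finrank_and_norm`), that is `p` for powers of a prime `p` and `1` otherwise. As `|N w|`
decays exponentially in the degree, the degree is bounded. The square of a quintic (`quintic_bound`)
serves general `d`; it is too weak for `d = 3, 4, 5, 7`, which get polynomials of their own.

For large `d` the resulting inequality fails already for relative degree `1`, because `φ(d)` is at
least of order `d^(3/4)`; the other `d` are checked numerically. Finiteness of the set of fields
then follows because `α` has degree at most `44` and all its conjugates are at most `196`. -/

/-! ### Embeddings of subfields of `ℝ`; conjugates of cosines -/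

theorem ringHom_ext_adjoin {S : Set ℝ} {A : Type*} [Field A]
    {φ ψ : IntermediateField.adjoin ℚ S →+* A}
    (h : ∀ x (hx : x ∈ S), φ ⟨x, IntermediateField.subset_adjoin ℚ S hx⟩ =
      ψ ⟨x, IntermediateField.subset_adjoin ℚ S hx⟩) : φ = ψ := by
  ext ⟨x, hx⟩
  induction hx using IntermediateField.adjoin_induction with
  | mem x hx => exact h x hx
  | algebraMap q =>
    exact (map_ratCast φ q).trans (map_ratCast ψ q).symm
  | add x y hx hy h₁ h₂ =>
    exact (map_add φ ⟨x, hx⟩ ⟨y, hy⟩).trans (by rw [h₁, h₂, ← map_add])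
  | inv x hx h₁ =>
    exact (map_inv₀ φ ⟨x, hx⟩).trans (by rw [h₁, ← map_inv₀])
  | mul x y hx hy h₁ h₂ =>
    exact (map_mul φ ⟨x, hx⟩ ⟨y, hy⟩).trans (by rw [h₁, h₂, ← map_mul])

theorem isTotallyReal_adjoin {S : Set ℝ}
    (h : ∀ φ : IntermediateField.adjoin ℚ S →+* ℂ, ∀ x (hx : x ∈ S),
      ∃ r : ℝ, φ ⟨x, IntermediateField.subset_adjoin ℚ S hx⟩ = r) :
    IsTotallyReal (IntermediateField.adjoin ℚ S) where
  isReal v := by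
    rw [← InfinitePlace.mk_embedding v, InfinitePlace.isReal_mk_iff, ComplexEmbedding.isReal_iff]
    refine ringHom_ext_adjoin fun x hx => ?_
    obtain ⟨r, hr⟩ := h v.embedding x hx
    rw [ComplexEmbedding.conjugate_coe_eq, hr, Complex.conj_ofReal]

/-- The real embedding underlying a complex embedding of a totally real field. -/
theorem exists_real_embedding {L : Type*} [Field L] [IsTotallyReal L] (φ : L →+* ℂ) :
    ∃ σ : L →+* ℝ, ∀ x, φ x = σ x :=
  ⟨(IsTotallyReal.complexEmbedding_isReal φ).embedding, fun x =>
    ((IsTotallyReal.complexEmbedding_isReal φ).coe_embedding_apply x).symm⟩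

/-- Writing `z = cos w` gives `n w ∈ 2πℤ`, so `w` is real. The equation `T_n = 1` is preserved by
field embeddings, hence every conjugate of `cos(π/d)` is again a real cosine. -/
theorem exists_eq_cos_of_eval_T_eq_one {n : ℕ} (hn : n ≠ 0) {z : ℂ}
    (h : (Chebyshev.T ℂ n).eval z = 1) : ∃ θ : ℝ, z = (Real.cos θ : ℝ) := by
  obtain ⟨w, rfl⟩ := Complex.cos_surjective z
  rw [Chebyshev.T_complex_cos, Complex.cos_eq_one_iff] at h
  obtain ⟨k, hk⟩ := h
  refine ⟨k * (2 * Real.pi) / n, ?_⟩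
  have hn' : (n : ℂ) ≠ 0 := by exact_mod_cast hn
  have : w = k * (2 * Real.pi) / n := by
    rw [hk]; push_cast; field_simp
  rw [this]; push_cast; rfl

theorem exists_map_eq_cos {L : Type*} [Field L] {n : ℕ} (hn : n ≠ 0) {x : L}
    (h : (Chebyshev.T L n).eval x = 1) (φ : L →+* ℂ) : ∃ θ : ℝ, φ x = (Real.cos θ : ℝ) := by
  refine exists_eq_cos_of_eval_T_eq_one hn ?_
  have := hom_eval₂ (Chebyshev.T L n) (RingHom.id L) φ x
  rw [eval₂_id, h, map_one] at this
  rw [← Chebyshev.map_T φ, eval_map, this, RingHom.comp_id]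

theorem eval_T_coe {K : IntermediateField ℚ ℝ} (n : ℤ) (x : K) :
    (((Chebyshev.T K n).eval x : K) : ℝ) = (Chebyshev.T ℝ n).eval (x : ℝ) := by
  have := hom_eval₂ (Chebyshev.T K n) (RingHom.id K) K.val.toRingHom x
  rw [eval₂_id] at this
  refine this.trans ?_
  rw [← Chebyshev.map_T (K.val.toRingHom), eval_map]; rfl

theorem exists_map_cos_pi_div {K : IntermediateField ℚ ℝ} {d : ℕ} (hd : d ≠ 0)
    (h : Real.cos (Real.pi / d) ∈ K) (φ : K →+* ℂ) :
    ∃ θ : ℝ, φ ⟨_, h⟩ = (Real.cos θ : ℝ) := by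
  have hd' : (d : ℝ) ≠ 0 := by exact_mod_cast hd
  refine exists_map_eq_cos (n := 2 * d) (by omega) (Subtype.ext ?_) φ
  rw [eval_T_coe, Chebyshev.T_real_cos]
  push_cast
  rw [show 2 * (d : ℝ) * (Real.pi / d) = 2 * Real.pi by field_simp, Real.cos_two_pi]

/-- Only the square is assumed to lie in `K`, so the Chebyshev equation is applied to `2y - 1 =
cos(2π/d)`. -/
theorem exists_map_cos_sq_pi_div {K : IntermediateField ℚ ℝ} {d : ℕ} (hd : d ≠ 0)
    (h : Real.cos (Real.pi / d) ^ 2 ∈ K) (φ : K →+* ℂ) :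
    ∃ θ : ℝ, φ ⟨_, h⟩ = (Real.cos θ ^ 2 : ℝ) := by
  have hd' : (d : ℝ) ≠ 0 := by exact_mod_cast hd
  set y : K := ⟨_, h⟩
  obtain ⟨θ, hθ⟩ := exists_map_eq_cos (x := 2 * y - 1) hd (by
    refine Subtype.ext ?_
    rw [eval_T_coe]
    have : ((2 * y - 1 : K) : ℝ) = Real.cos (2 * (Real.pi / d)) := by
      rw [Real.cos_two_mul]; rfl
    rw [this, Chebyshev.T_real_cos]
    push_cast
    rw [show (d : ℝ) * (2 * (Real.pi / d)) = 2 * Real.pi by field_simp, Real.cos_two_pi]) φ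
  refine ⟨θ / 2, ?_⟩
  rw [map_sub, map_mul, map_ofNat, map_one] at hθ
  have h2 : Real.cos θ = 2 * Real.cos (θ / 2) ^ 2 - 1 := by
    rw [← Real.cos_two_mul]; congr 1; ring
  rw [h2] at hθ
  push_cast at hθ ⊢
  linear_combination hθ / 2

theorem exists_real_map_cos_sq_pi_div {K : IntermediateField ℚ ℝ} {d : ℕ} (hd : d ≠ 0)
    (h : Real.cos (Real.pi / d) ^ 2 ∈ K) (σ : K →+* ℝ) :
    ∃ θ : ℝ, σ ⟨_, h⟩ = Real.cos θ ^ 2 := by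
  obtain ⟨θ, hθ⟩ := exists_map_cos_sq_pi_div hd h (Complex.ofRealHom.comp σ)
  exact ⟨θ, Complex.ofReal_injective hθ⟩

/-- The number is a sum of two roots of unity of order dividing `2d`. -/
theorem isIntegral_two_mul_cos {d : ℕ} (hd : d ≠ 0) :
    IsIntegral ℤ (2 * Real.cos (Real.pi / d)) := by
  have hd' : (d : ℝ) ≠ 0 := by exact_mod_cast hd
  have hd'' : (d : ℂ) ≠ 0 := by exact_mod_cast hd
  have key : ∀ ε : ℂ, ε ^ 2 = -1 → IsIntegral ℤ (Complex.exp (Real.pi / d * ε)) := by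
    intro ε hε
    refine IsIntegral.of_pow (n := 2 * d) (by omega) ?_
    rw [← Complex.exp_nat_mul]
    have h1 : ε = Complex.I ∨ ε = -Complex.I := by
      rw [← sq_eq_sq_iff_eq_or_eq_neg, hε, Complex.I_sq]
    have : Complex.exp ((2 * d : ℕ) * (Real.pi / d * ε)) = 1 := by
      rcases h1 with rfl | rfl
      · rw [← Complex.exp_two_pi_mul_I]; congr 1; push_cast; field_simp
      · rw [← inv_inj, inv_one, ← Complex.exp_neg, ← Complex.exp_two_pi_mul_I]
        congr 1; push_cast; field_simp
    rw [this]; exact isIntegral_one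
  have h := (key Complex.I Complex.I_sq).add (key (-Complex.I) (by simp))
  have hinj : Function.Injective (algebraMap ℝ ℂ) := (algebraMap ℝ ℂ).injective
  rw [← isIntegral_algebraMap_iff hinj]
  have he : algebraMap ℝ ℂ (2 * Real.cos (Real.pi / d)) =
      Complex.exp (Real.pi / d * Complex.I) + Complex.exp (Real.pi / d * -Complex.I) := by
    rw [Complex.coe_algebraMap]
    push_cast
    rw [Complex.cos]
    ring_nf
  rw [he]
  exact h

theorem four_mul_sin_sq_eq (x : ℝ) : 4 * Real.sin x ^ 2 = 4 - (2 * Real.cos x) ^ 2 := by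
  rw [Real.sin_sq]; ring

theorem isIntegral_four_mul_sin_sq {d : ℕ} (hd : d ≠ 0) :
    IsIntegral ℤ (4 * Real.sin (Real.pi / d) ^ 2) := by
  rw [four_mul_sin_sq_eq]
  exact (isIntegral_algebraMap (x := (4 : ℤ))).sub ((isIntegral_two_mul_cos hd).pow 2)

theorem exists_extension {K L : IntermediateField ℚ ℝ} (hKL : K ≤ L)
    (hL : ∀ x ∈ L, IsAlgebraic ℚ x) (φ : K →+* ℂ) :
    ∃ ψ : L →+* ℂ, ∀ x (hx : x ∈ K), ψ ⟨x, hKL hx⟩ = φ ⟨x, hx⟩ := by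
  let _ : Algebra K L := (IntermediateField.inclusion hKL).toAlgebra
  let _ : Algebra K ℂ := φ.toAlgebra
  have : Algebra.IsAlgebraic K L := ⟨fun x => by
    have h1 : IsAlgebraic ℚ x := by
      have := hL x x.2
      exact (isAlgebraic_algebraMap_iff (algebraMap L ℝ).injective).1 this
    have : IsScalarTower ℚ K L := IsScalarTower.of_algebraMap_eq fun q => rfl
    exact h1.tower_top K⟩
  let ψ : L →ₐ[K] ℂ := IsAlgClosed.lift
  exact ⟨ψ.toRingHom, fun x hx => ψ.commutes ⟨x, hx⟩⟩

theorem cos_pi_div_pos {d : ℕ} (hd : 3 ≤ d) : 0 < Real.cos (Real.pi / d) := by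
  have h3 : (3 : ℝ) ≤ d := by exact_mod_cast hd
  apply Real.cos_pos_of_mem_Ioo
  constructor
  · have : 0 < Real.pi / d := by positivity
    linarith [Real.pi_pos]
  · rw [div_lt_iff₀ (by linarith)]
    nlinarith [Real.pi_pos]

theorem cos_pi_div_lt_one {d : ℕ} (hd : 3 ≤ d) : Real.cos (Real.pi / d) < 1 := by
  have h3 : (3 : ℝ) ≤ d := by exact_mod_cast hd
  rw [← Real.cos_zero]
  have h0 : 0 < Real.pi / d := by positivity
  refine Real.cos_lt_cos_of_nonneg_of_le_pi le_rfl ?_ h0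
  rw [div_le_iff₀ (by linarith)]
  nlinarith [Real.pi_pos]

/-! ### The ground field and the entry field -/

theorem prod_div_cyclic {n : ℕ} (g : Fin (n + 1) → ℝ) (hg : ∀ i, g i ≠ 0) :
    ∏ j, g j * (g (j + 1))⁻¹ = 1 := by
  have h : ∏ j, g (j + 1) = ∏ j, g j := Equiv.prod_comp (Equiv.addRight 1) g
  rw [Finset.prod_mul_distrib, Finset.prod_inv_distrib, h, mul_inv_cancel₀]
  exact Finset.prod_ne_zero_iff.2 fun i _ => hg i

theorem cosField_le_fieldOf (d : ℕ) (α : ℝ) : cosField d ≤ fieldOf d α :=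
  IntermediateField.adjoin.mono _ _ _ (by simp)

theorem adjoin_le_fieldOf (d : ℕ) (α : ℝ) : ℚ⟮α⟯ ≤ fieldOf d α :=
  IntermediateField.adjoin.mono _ _ _ (by simp)

theorem groundField_gramΓ₂ {d : ℕ} {u : ℝ} (hd : 3 ≤ d) (hu : 0 < u) :
    groundField (gramΓ₂ d u) = fieldOf d (u ^ 2) := by
  have hc := (cos_pi_div_pos hd).ne'
  apply le_antisymm
  · refine IntermediateField.adjoin_le_iff.2 ?_
    rintro b ⟨n, i, rfl⟩
    -- Conjugation by the diagonal matrix of `g` leaves cyclic products unchanged and turns the Gram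
    -- matrix into `B`, whose entries already lie in the smaller field.
    let g : Fin 3 → ℝ := ![u, 1, 2 * Real.cos (Real.pi / d)]
    let B : Matrix (Fin 3) (Fin 3) ℝ := !![-2, 1, 0; u ^ 2, -2, 4 * Real.cos (Real.pi / d) ^ 2;
      0, 1, -2]
    have hg : ∀ i, g i ≠ 0 := by
      intro i; fin_cases i <;> simp [g, hc, hu.ne']
    have hA : ∀ i j, gramΓ₂ d u i j = g i * (g j)⁻¹ * B i j := by
      intro i j
      fin_cases i <;> fin_cases j <;> simp [g, B, gramΓ₂] <;> field_simp
      all_goals norm_num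
    have hB : ∀ i j, B i j ∈ fieldOf d (u ^ 2) := by
      have h2 : (-2 : ℝ) ∈ fieldOf d (u ^ 2) := neg_mem (ofNat_mem _ 2)
      have h4 : 4 * Real.cos (Real.pi / d) ^ 2 ∈ fieldOf d (u ^ 2) :=
        mul_mem (ofNat_mem _ 4) (IntermediateField.subset_adjoin ℚ _ (by simp))
      intro i j
      fin_cases i <;> fin_cases j <;>
        first
        | exact h2
        | exact one_mem _
        | exact zero_mem _
        | exact h4
        | exact mem_fieldOf d (u ^ 2)
    have : ∏ j, gramΓ₂ d u (i j) (i (j + 1)) = ∏ j, B (i j) (i (j + 1)) := by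
      simp_rw [hA]
      rw [Finset.prod_mul_distrib, prod_div_cyclic (fun j => g (i j)) (fun j => hg _), one_mul]
    rw [this]
    exact prod_mem fun j _ => hB _ _
  · refine IntermediateField.adjoin_le_iff.2 ?_
    have key : ∀ x y, IsCyclicProduct (gramΓ₂ d u) (gramΓ₂ d u x y * gramΓ₂ d u y x) := fun x y =>
      ⟨1, ![x, y], by simp [Fin.prod_univ_two]⟩
    rintro x (rfl | rfl)
    · refine IntermediateField.subset_adjoin ℚ _ ?_
      convert key 0 1 using 1
      simp [gramΓ₂, sq]
    · have h : gramΓ₂ d u 1 2 * gramΓ₂ d u 2 1 ∈ groundField (gramΓ₂ d u) :=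
        IntermediateField.subset_adjoin ℚ _ (key 1 2)
      have h4 : (4 : ℝ) ∈ groundField (gramΓ₂ d u) := ofNat_mem _ 4
      have he : Real.cos (Real.pi / d) ^ 2 = gramΓ₂ d u 1 2 * gramΓ₂ d u 2 1 / 4 := by
        simp [gramΓ₂]; ring
      rw [he]
      exact div_mem h h4

theorem groundField_le_entryField {ι : Type*} (A : Matrix ι ι ℝ) :
    groundField A ≤ entryField A := by
  refine IntermediateField.adjoin_le_iff.2 ?_
  rintro b ⟨n, i, rfl⟩
  exact prod_mem fun j _ => IntermediateField.subset_adjoin ℚ _ ⟨_, _, rfl⟩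

theorem u_mem_entryField (d : ℕ) (u : ℝ) : u ∈ entryField (gramΓ₂ d u) :=
  IntermediateField.subset_adjoin ℚ _ ⟨0, 1, by simp [gramΓ₂]⟩

theorem cos_mem_entryField (d : ℕ) (u : ℝ) :
    2 * Real.cos (Real.pi / d) ∈ entryField (gramΓ₂ d u) :=
  IntermediateField.subset_adjoin ℚ _ ⟨1, 2, by simp [gramΓ₂]⟩

theorem entryMatrix_map {d : ℕ} {u : ℝ} {R : Type*} [Field R]
    (σ : entryField (gramΓ₂ d u) →+* R) :
    (entryMatrix (gramΓ₂ d u)).map σ =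
      !![-2, σ ⟨u, u_mem_entryField d u⟩, 0;
        σ ⟨u, u_mem_entryField d u⟩, -2, σ ⟨_, cos_mem_entryField d u⟩;
        0, σ ⟨_, cos_mem_entryField d u⟩, -2] := by
  have h2 : ∀ h : (-2 : ℝ) ∈ entryField (gramΓ₂ d u), σ ⟨-2, h⟩ = -2 := fun h => by
    rw [show (⟨-2, h⟩ : entryField (gramΓ₂ d u)) = -2 from rfl, map_neg, map_ofNat]
  have h0 : ∀ h : (0 : ℝ) ∈ entryField (gramΓ₂ d u), σ ⟨0, h⟩ = 0 := fun h => map_zero σ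
  ext i j
  fin_cases i <;> fin_cases j <;>
    first
    | exact h2 _
    | exact h0 _
    | rfl

theorem isAlgebraic_of_mem_adjoin {S : Set ℝ} (h : ∀ x ∈ S, IsIntegral ℤ x) :
    ∀ x ∈ IntermediateField.adjoin ℚ S, IsAlgebraic ℚ x := by
  have := IntermediateField.isAlgebraic_adjoin (K := ℚ) (S := S) fun x hx =>
    ((h x hx).tower_top : IsIntegral ℚ x)
  intro x hx
  exact (isAlgebraic_algebraMap_iff (algebraMap (IntermediateField.adjoin ℚ S) ℝ).injective).2
    (this.isAlgebraic ⟨x, hx⟩)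

theorem isIntegral_entry {d : ℕ} {u : ℝ} (hd : d ≠ 0) (hu : IsIntegral ℤ (u ^ 2)) (i j : Fin 3) :
    IsIntegral ℤ (gramΓ₂ d u i j) := by
  have h1 : IsIntegral ℤ u := hu.of_pow (by norm_num)
  have h2 : IsIntegral ℤ (-2 : ℝ) := by simpa using isIntegral_algebraMap (R := ℤ) (A := ℝ) (x := -2)
  have h3 := isIntegral_two_mul_cos hd
  fin_cases i <;> fin_cases j <;>
    first
    | exact h2
    | exact isIntegral_zero
    | exact h1
    | exact h3

/-! ### Signature of the form and the equivalence of the two descriptions -/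

theorem dotProduct_mulVec_gram {R : Type*} [Field R] (a b : R) (x : Fin 3 → R) :
    x ⬝ᵥ (!![-2, a, 0; a, -2, b; 0, b, -2] : Matrix (Fin 3) (Fin 3) R).mulVec x =
      -2 * x 0 ^ 2 + 2 * a * x 0 * x 1 - 2 * x 1 ^ 2 + 2 * b * x 1 * x 2 - 2 * x 2 ^ 2 := by
  simp [Matrix.mulVec, dotProduct, Fin.sum_univ_three]
  ring

theorem gram_form_neg {a b : ℝ} (h : a ^ 2 + b ^ 2 < 4) {x : Fin 3 → ℝ} (hx : x ≠ 0) :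
    x ⬝ᵥ (!![-2, a, 0; a, -2, b; 0, b, -2] : Matrix (Fin 3) (Fin 3) ℝ).mulVec x < 0 := by
  rw [dotProduct_mulVec_gram]
  have key : -2 * x 0 ^ 2 + 2 * a * x 0 * x 1 - 2 * x 1 ^ 2 + 2 * b * x 1 * x 2 - 2 * x 2 ^ 2 =
    -(2 * (x 0 - a / 2 * x 1) ^ 2 + 2 * (x 2 - b / 2 * x 1) ^ 2 +
      (4 - (a ^ 2 + b ^ 2)) / 2 * x 1 ^ 2) := by ring
  rw [key, neg_lt_zero]
  have h4 : 0 < (4 - (a ^ 2 + b ^ 2)) / 2 := by linarith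
  by_contra hcon
  have h1 : x 1 = 0 := by
    have : (4 - (a ^ 2 + b ^ 2)) / 2 * x 1 ^ 2 ≤ 0 := by
      nlinarith [sq_nonneg (x 0 - a / 2 * x 1), sq_nonneg (x 2 - b / 2 * x 1)]
    have : x 1 ^ 2 ≤ 0 := nonpos_of_mul_nonpos_right this h4
    exact pow_eq_zero_iff two_ne_zero |>.1 (le_antisymm this (sq_nonneg _))
  rw [h1] at hcon
  have h0 : x 0 = 0 := by nlinarith [sq_nonneg (x 0), sq_nonneg (x 2)]
  have h2 : x 2 = 0 := by nlinarith [sq_nonneg (x 0), sq_nonneg (x 2)]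
  apply hx
  ext i; fin_cases i <;> assumption

theorem isNegDefModKernel_gram {a b : ℝ} (h : a ^ 2 + b ^ 2 < 4) :
    IsNegDefModKernel !![-2, a, 0; a, -2, b; 0, b, -2] := fun x hx =>
  gram_form_neg h fun h0 => hx (by rw [h0, Matrix.mulVec_zero])

theorem posDef_neg_gram {a b : ℝ} (h : a ^ 2 + b ^ 2 < 4) :
    (-(!![-2, a, 0; a, -2, b; 0, b, -2] : Matrix (Fin 3) (Fin 3) ℝ)).PosDef := by
  refine Matrix.PosDef.of_dotProduct_mulVec_pos ?_ fun x hx => ?_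
  · ext i j
    fin_cases i <;> fin_cases j <;> simp
  · rw [Matrix.neg_mulVec, dotProduct_neg, star_trivial, neg_pos]
    exact gram_form_neg h hx

theorem le_four_of_isNegDefModKernel {a b : ℝ}
    (h : IsNegDefModKernel !![-2, a, 0; a, -2, b; 0, b, -2]) : a ^ 2 + b ^ 2 ≤ 4 := by
  by_contra hcon
  push Not at hcon
  -- On this vector the form equals `2(a² + b²) - 8`, and the middle coordinate of its image is `a²
  -- + b² - 4`.
  have := h ![a, 2, b] (fun h0 => by
    have := congrFun h0 1
    simp [Matrix.mulVec, dotProduct, Fin.sum_univ_three] at this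
    nlinarith)
  rw [dotProduct_mulVec_gram] at this
  simp at this
  nlinarith

theorem sq_eq_four_sub {d : ℕ} {u : ℝ} {R : Type*} [Field R] (σ : entryField (gramΓ₂ d u) →+* R)
    (h : 4 * Real.sin (Real.pi / d) ^ 2 ∈ entryField (gramΓ₂ d u)) :
    σ ⟨_, cos_mem_entryField d u⟩ ^ 2 = 4 - σ ⟨_, h⟩ := by
  rw [← map_pow, ← map_ofNat σ 4, ← map_sub]
  congr 1
  refine Subtype.ext ?_
  have hs : (2 * Real.cos (Real.pi / d)) ^ 2 = 4 - 4 * Real.sin (Real.pi / d) ^ 2 := by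
    rw [Real.sin_sq]; ring
  exact (SubmonoidClass.coe_pow _ _).trans hs

theorem four_sin_sq_lt_four {d : ℕ} (hd : 3 ≤ d) : 4 * Real.sin (Real.pi / d) ^ 2 < 4 := by
  rw [Real.sin_sq]
  have := cos_pi_div_pos hd
  nlinarith [sq_nonneg (Real.cos (Real.pi / d)), pow_pos this 2]

theorem IsΓ₂.isAdmissible {t : ℝ} {d : ℕ} {u : ℝ} (h : IsΓ₂ t d u) :
    IsAdmissible t d (u ^ 2) := by
  have hd := h.three_le
  have hd0 : d ≠ 0 := by omega
  have hu : 0 < u := by linarith [h.two_lt]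
  have hint : IsIntegral ℤ (u ^ 2) := h.arithmetic.integral _
    ⟨1, ![0, 1], by simp [Fin.prod_univ_two, gramΓ₂, sq]⟩
  have hK := groundField_gramΓ₂ hd hu
  have hle : fieldOf d (u ^ 2) ≤ entryField (gramΓ₂ d u) := hK ▸ groundField_le_entryField _
  have halg : ∀ x ∈ entryField (gramΓ₂ d u), IsAlgebraic ℚ x :=
    isAlgebraic_of_mem_adjoin (by rintro x ⟨i, j, rfl⟩; exact isIntegral_entry hd0 hint i j)
  have hTR := h.arithmetic.totallyReal
  refine ⟨hint, ?_, ?_, by nlinarith [h.two_lt], ?_⟩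
  · refine isTotallyReal_adjoin ?_
    intro φ x hx
    obtain ⟨ψ, hψ⟩ := exists_extension ((adjoin_le_fieldOf d (u ^ 2)).trans hle) halg φ
    obtain ⟨σ, hσ⟩ := exists_real_embedding ψ
    exact ⟨_, (hψ _ _).symm.trans (hσ _)⟩
  · rintro τ ⟨y, hy⟩
    -- Vinberg's condition concerns embeddings of the entry field. `τ` extends to it over `ℂ`, and
    -- the extension is real because the entry field is totally real.
    obtain ⟨ψ, hψ⟩ := exists_extension hle halg (Complex.ofRealHom.comp τ)
    obtain ⟨σ, hσ⟩ := exists_real_embedding ψ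
    have hτ : ∀ x (hx : x ∈ fieldOf d (u ^ 2)), σ ⟨x, hle hx⟩ = τ ⟨x, hx⟩ := fun x hx =>
      Complex.ofReal_injective ((hσ _).symm.trans (hψ x hx))
    have hneg := h.arithmetic.negDef σ ⟨⟨y, hle y.2⟩, by rw [hK]; exact y.2, by
      rw [hτ y y.2]; exact hy⟩
    rw [entryMatrix_map] at hneg
    have h4 := le_four_of_isNegDefModKernel hneg
    rw [sq_eq_four_sub σ (hle (four_sin_sq_mem_fieldOf d _)),
      hτ _ (four_sin_sq_mem_fieldOf d _)] at h4
    have hsq : (⟨u, u_mem_entryField d u⟩ : entryField (gramΓ₂ d u)) ^ 2 =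
        ⟨u ^ 2, hle (mem_fieldOf d _)⟩ := Subtype.ext (SubmonoidClass.coe_pow _ _)
    have hu2 : σ (⟨u, u_mem_entryField d u⟩ ^ 2) = τ ⟨u ^ 2, mem_fieldOf d _⟩ := by
      rw [hsq, hτ]
    have hpos : 0 < σ (⟨u, u_mem_entryField d u⟩ ^ 2) := by
      rw [map_pow]
      have : σ ⟨u, u_mem_entryField d u⟩ ≠ 0 := by
        rw [_root_.map_ne_zero]
        intro h0
        exact hu.ne' (congrArg Subtype.val h0)
      positivity
    rw [map_pow] at hu2 hpos
    -- Definiteness modulo the kernel gives only `≤`. Equality would pull back along the injective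
    -- `τ` to `u² = 4 sin²(π/d) < 4`.
    refine ⟨hu2 ▸ hpos, lt_of_le_of_ne (by linarith) fun heq => ?_⟩
    have := congrArg Subtype.val (τ.injective heq)
    have h5 := four_sin_sq_lt_four hd
    change u ^ 2 = 4 * Real.sin (Real.pi / d) ^ 2 at this
    nlinarith [h.two_lt]
  · have := h.minimality 0 1
    simp [gramΓ₂] at this
    nlinarith

theorem isFundamental_gramΓ₂ {d : ℕ} {u : ℝ} (hd : 3 ≤ d) (hu : 2 < u) :
    IsFundamental (gramΓ₂ d u) := by
  have hc := cos_pi_div_pos hd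
  have h2 : ∃ m : ℕ, 2 ≤ m ∧ (0 : ℝ) = 2 * Real.cos (Real.pi / m) := ⟨2, le_rfl, by simp⟩
  have h3 : ∃ m : ℕ, 2 ≤ m ∧ 2 * Real.cos (Real.pi / d) = 2 * Real.cos (Real.pi / m) :=
    ⟨d, by omega, rfl⟩
  refine ⟨?_, ?_, ?_, ?_⟩
  · ext i j
    fin_cases i <;> fin_cases j <;> simp [gramΓ₂]
  · intro i
    fin_cases i <;> simp [gramΓ₂]
  · intro i j hij
    fin_cases i <;> fin_cases j <;> simp [gramΓ₂] at hij ⊢ <;> linarith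
  · intro i j hij
    fin_cases i <;> fin_cases j <;> intro h <;>
      first
      | exact absurd rfl hij
      | exact h2
      | exact h3
      | exact absurd h (not_lt.2 hu.le)

theorem quadraticForm_gramΓ₂ (d : ℕ) (u : ℝ) (x : Fin 3 → ℝ) :
    Matrix.toQuadraticForm' (gramΓ₂ d u) x =
      -2 * x 0 ^ 2 + 2 * u * x 0 * x 1 - 2 * x 1 ^ 2 +
        2 * (2 * Real.cos (Real.pi / d)) * x 1 * x 2 - 2 * x 2 ^ 2 := by
  rw [← dotProduct_mulVec_gram]
  simp [Matrix.toQuadraticForm', Matrix.toLinearMap₂'_apply', gramΓ₂]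

/-- The form is nonpositive on the plane spanned by the first and third basis vectors, so the
positive index is at most `1`; on `(1, 1, 0)` it equals `2u - 4 > 0`. -/
theorem isHyperbolic_gramΓ₂ {d : ℕ} {u : ℝ} (hu : 2 < u) :
    IsHyperbolic (gramΓ₂ d u) := by
  refine le_antisymm ?_ ?_
  · have hV : ∀ x ∈ Submodule.span ℝ {(Pi.single 0 1 : Fin 3 → ℝ), Pi.single 2 1},
        Matrix.toQuadraticForm' (gramΓ₂ d u) x ≤ 0 := by
      intro x hx
      obtain ⟨a, b, rfl⟩ := Submodule.mem_span_pair.1 hx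
      rw [quadraticForm_gramΓ₂]
      simp
      nlinarith [sq_nonneg a, sq_nonneg b]
    have h := QuadraticForm.sigPos_add_finrank_le_of_nonpos hV
    have hli : LinearIndependent ℝ ![(Pi.single 0 1 : Fin 3 → ℝ), Pi.single 2 1] := by
      refine LinearIndependent.pair_iff.2 fun s t hst => ?_
      have h0 := congrFun hst 0
      have h2 := congrFun hst 2
      simp at h0 h2
      exact ⟨h0, h2⟩
    have h2 := finrank_span_eq_card hli
    rw [Matrix.range_cons, Matrix.range_cons, Matrix.range_empty, Set.union_empty,
      Set.singleton_union] at h2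
    rw [h2] at h
    simp at h
    exact Nat.le_of_lt_succ (by omega)
  · have hne : (![1, 1, 0] : Fin 3 → ℝ) ≠ 0 := fun h => by simpa using congrFun h 0
    rw [← finrank_span_singleton (K := ℝ) hne]
    refine le_sigPos_of_posDef _ fun x hx => ?_
    obtain ⟨x, hxm⟩ := x
    obtain ⟨a, rfl⟩ := Submodule.mem_span_singleton.1 hxm
    have ha : a ≠ 0 := by
      rintro rfl
      exact hx (Subtype.ext (by simp))
    rw [QuadraticMap.restrict_apply, quadraticForm_gramΓ₂]
    simp
    have := sq_pos_of_ne_zero ha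
    nlinarith

theorem cos_sq_lt_four {d : ℕ} (hd : 3 ≤ d) : (2 * Real.cos (Real.pi / d)) ^ 2 < 4 := by
  have h0 := cos_pi_div_pos hd
  have h1 := cos_pi_div_lt_one hd
  nlinarith

theorem isFiniteEdge_gramΓ₂ {d : ℕ} {u : ℝ} (hd : 3 ≤ d) (hu : 2 < u) :
    IsFiniteEdge (gramΓ₂ d u) 0 1 := by
  refine ⟨by simp, isFundamental_gramΓ₂ hd hu, isHyperbolic_gramΓ₂ hu, ?_, ?_⟩
  · have h := (posDef_neg_gram (a := 0) (b := 2 * Real.cos (Real.pi / d))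
      (by simpa using cos_sq_lt_four hd)).submatrix
      (e := fun i : {i : Fin 3 // i ≠ 0} => i.1) Subtype.val_injective
    convert h using 1
    ext ⟨i, hi⟩ ⟨j, hj⟩
    fin_cases i <;> fin_cases j <;> simp [gramΓ₂] at hi hj ⊢
  · have h := (posDef_neg_gram (a := 0) (b := 0) (by norm_num)).submatrix
      (e := fun i : {i : Fin 3 // i ≠ 1} => i.1) Subtype.val_injective
    convert h using 1
    ext ⟨i, hi⟩ ⟨j, hj⟩
    fin_cases i <;> fin_cases j <;> simp [gramΓ₂] at hi hj ⊢

theorem connected_gramΓ₂ {d : ℕ} {u : ℝ} (hd : 3 ≤ d) (hu : 2 < u) :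
    (gramGraph (gramΓ₂ d u)).Connected := by
  have hc := (cos_pi_div_pos hd).ne'
  have h01 : (gramGraph (gramΓ₂ d u)).Adj 0 1 := by
    simp [gramGraph, SimpleGraph.fromRel_adj, gramΓ₂]
    linarith
  have h12 : (gramGraph (gramΓ₂ d u)).Adj 1 2 := by
    simp [gramGraph, SimpleGraph.fromRel_adj, gramΓ₂, hc]
  have : ∀ i, (gramGraph (gramΓ₂ d u)).Reachable 1 i := by
    intro i
    fin_cases i
    · exact h01.symm.reachable
    · exact SimpleGraph.Reachable.refl _
    · exact h12.reachable
  exact ⟨fun i j => (this i).symm.trans (this j)⟩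

/-! ### From admissible `α` back to arithmetic graphs; `𝕂 = ℚ(α)` -/

section Admissible

variable {t : ℝ} {d : ℕ} {α : ℝ}

theorem IsAdmissible.isTotallyReal_fieldOf (h : IsAdmissible t d α) (hd : d ≠ 0) :
    IsTotallyReal (fieldOf d α) := by
  have hTR := h.totallyReal
  refine isTotallyReal_adjoin fun φ x hx => ?_
  rcases hx with rfl | rfl
  · obtain ⟨σ, hσ⟩ := exists_real_embedding
      (φ.comp (IntermediateField.inclusion (adjoin_le_fieldOf d x)).toRingHom)
    exact ⟨_, hσ ⟨x, IntermediateField.mem_adjoin_simple_self ℚ x⟩⟩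
  · obtain ⟨θ, hθ⟩ := exists_map_cos_sq_pi_div hd (K := fieldOf d α)
      (IntermediateField.subset_adjoin ℚ _ (by simp)) φ
    exact ⟨_, hθ⟩

theorem IsAdmissible.map_pos (h : IsAdmissible t d α) (σ : fieldOf d α →+* ℝ) :
    0 < σ ⟨α, mem_fieldOf d α⟩ := by
  by_cases hσ : ∃ x : fieldOf d α, σ x ≠ (x : ℝ)
  · exact (h.conj σ hσ).1
  · push Not at hσ
    rw [hσ]
    exact lt_trans (by norm_num) h.lower

theorem isTotallyReal_entryField {ι : Type*} {A : Matrix ι ι ℝ}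
    (h : ∀ φ : entryField A →+* ℂ, ∀ i j, ∃ r : ℝ, (entryMatrix A).map φ i j = r) :
    IsTotallyReal (entryField A) := by
  refine isTotallyReal_adjoin ?_
  rintro φ x ⟨i, j, rfl⟩
  exact h φ i j

theorem exists_real_map_cos {d : ℕ} {u : ℝ} (hd : d ≠ 0)
    (φ : entryField (gramΓ₂ d u) →+* ℂ) : ∃ r : ℝ, φ ⟨_, cos_mem_entryField d u⟩ = r := by
  have hmem : Real.cos (Real.pi / d) ∈ entryField (gramΓ₂ d u) := by
    have h2 : (2 : ℝ) ∈ entryField (gramΓ₂ d u) := ofNat_mem _ 2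
    have := div_mem (cos_mem_entryField d u) h2
    rwa [mul_div_cancel_left₀ _ two_ne_zero] at this
  have he : (⟨_, cos_mem_entryField d u⟩ : entryField (gramΓ₂ d u)) = ⟨_, hmem⟩ + ⟨_, hmem⟩ :=
    Subtype.ext (two_mul _)
  obtain ⟨θ, hθ⟩ := exists_map_cos_pi_div hd hmem φ
  exact ⟨Real.cos θ + Real.cos θ, by rw [he, map_add, hθ, Complex.ofReal_add]⟩

theorem u_sq_eq {d : ℕ} {u : ℝ} (h : u ^ 2 ∈ entryField (gramΓ₂ d u)) :
    (⟨u, u_mem_entryField d u⟩ : entryField (gramΓ₂ d u)) ^ 2 = ⟨u ^ 2, h⟩ :=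
  Subtype.ext (SubmonoidClass.coe_pow _ _)

theorem exists_real_of_sq_eq {z : ℂ} {r : ℝ} (hr : 0 < r) (h : z ^ 2 = r) :
    ∃ x : ℝ, z = x := by
  have h3 : z ^ 2 = ((Real.sqrt r : ℝ) : ℂ) ^ 2 := by
    rw [h, ← Complex.ofReal_pow, Real.sq_sqrt hr.le]
  rcases sq_eq_sq_iff_eq_or_eq_neg.1 h3 with h4 | h4
  · exact ⟨_, h4⟩
  · exact ⟨-Real.sqrt r, by rw [h4]; push_cast; rfl⟩

theorem fieldOf_le_entryField {d : ℕ} {u : ℝ} (hd : 3 ≤ d) (hu : 0 < u) :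
    fieldOf d (u ^ 2) ≤ entryField (gramΓ₂ d u) :=
  groundField_gramΓ₂ hd hu ▸ groundField_le_entryField _

/-- The image of `u` is a square root of the positive real number `σ(α)`. This is where the
condition `0 < σ(α)` is needed. -/
theorem IsAdmissible.exists_real_map_u {u : ℝ} (hd : 3 ≤ d) (hu : 0 < u)
    (h : IsAdmissible t d (u ^ 2)) (φ : entryField (gramΓ₂ d u) →+* ℂ) :
    ∃ r : ℝ, φ ⟨u, u_mem_entryField d u⟩ = r := by
  have hle := fieldOf_le_entryField hd hu
  have hTR := h.isTotallyReal_fieldOf (by omega)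
  obtain ⟨σ, hσ⟩ := exists_real_embedding (φ.comp (IntermediateField.inclusion hle).toRingHom)
  refine exists_real_of_sq_eq (h.map_pos σ) ?_
  rw [← hσ, ← map_pow, u_sq_eq (hle (mem_fieldOf d _))]
  rfl

theorem IsAdmissible.isTotallyReal_entryField {u : ℝ} (hd : 3 ≤ d) (hu : 0 < u)
    (h : IsAdmissible t d (u ^ 2)) : IsTotallyReal (entryField (gramΓ₂ d u)) := by
  refine EdgeGraph.isTotallyReal_entryField fun φ => ?_
  rw [entryMatrix_map]
  obtain ⟨a, ha⟩ := h.exists_real_map_u hd hu φ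
  obtain ⟨b, hb⟩ := exists_real_map_cos (by omega) φ
  rw [ha, hb]
  have h2 : ∃ r : ℝ, (-2 : ℂ) = r := ⟨-2, by push_cast; rfl⟩
  have h0 : ∃ r : ℝ, (0 : ℂ) = r := ⟨0, by push_cast; rfl⟩
  intro i j
  fin_cases i <;> fin_cases j
  · exact h2
  · exact ⟨a, rfl⟩
  · exact h0
  · exact ⟨a, rfl⟩
  · exact h2
  · exact ⟨b, rfl⟩
  · exact h0
  · exact ⟨b, rfl⟩
  · exact h2

theorem IsAdmissible.isNegDefModKernel {u : ℝ} (hd : 3 ≤ d) (hu : 0 < u)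
    (h : IsAdmissible t d (u ^ 2)) (σ : entryField (gramΓ₂ d u) →+* ℝ)
    (hσ : ∃ x : entryField (gramΓ₂ d u), (x : ℝ) ∈ groundField (gramΓ₂ d u) ∧ σ x ≠ (x : ℝ)) :
    IsNegDefModKernel ((entryMatrix (gramΓ₂ d u)).map σ) := by
  have hle := fieldOf_le_entryField hd hu
  obtain ⟨y, hy, hσy⟩ := hσ
  rw [groundField_gramΓ₂ hd hu] at hy
  obtain ⟨-, h2⟩ := h.conj (σ.comp (IntermediateField.inclusion hle).toRingHom) ⟨⟨y, hy⟩, hσy⟩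
  rw [entryMatrix_map]
  refine isNegDefModKernel_gram ?_
  rw [sq_eq_four_sub σ (hle (four_sin_sq_mem_fieldOf d _)), ← map_pow,
    u_sq_eq (hle (mem_fieldOf d _))]
  have h3 : σ ⟨u ^ 2, hle (mem_fieldOf d _)⟩ < σ ⟨_, hle (four_sin_sq_mem_fieldOf d _)⟩ := h2
  linarith

theorem hasMinimality_gramΓ₂ {u : ℝ} (hd : 3 ≤ d) (hu : 2 < u) (h : u < t) :
    HasMinimality (gramΓ₂ d u) t := by
  have hc := cos_pi_div_lt_one hd
  intro i j
  fin_cases i <;> fin_cases j <;> simp [gramΓ₂] <;> linarith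

theorem IsAdmissible.isΓ₂ {u : ℝ} (hd : 3 ≤ d) (hu : 0 < u) (ht : 0 < t)
    (h : IsAdmissible t d (u ^ 2)) : IsΓ₂ t d u := by
  have hu2 : 2 < u := by nlinarith [h.lower]
  have hut : u < t := by nlinarith [h.upper]
  exact ⟨hd, hu2, hasMinimality_gramΓ₂ hd hu2 hut, connected_gramΓ₂ hd hu2,
    isFiniteEdge_gramΓ₂ hd hu2, isFundamental_gramΓ₂ hd hu2, isHyperbolic_gramΓ₂ hu2, by
      rintro b ⟨n, i, rfl⟩
      exact IsIntegral.prod _ fun j _ => isIntegral_entry (by omega) h.integral _ _,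
    h.isTotallyReal_entryField hd hu, h.isNegDefModKernel hd hu⟩

theorem IsAdmissible.map_lt_four (h : IsAdmissible t d α) (hd : d ≠ 0)
    {σ : fieldOf d α →+* ℝ} (hσ : ∃ x : fieldOf d α, σ x ≠ (x : ℝ)) :
    σ ⟨α, mem_fieldOf d α⟩ < 4 := by
  refine (h.conj σ hσ).2.trans_le ?_
  obtain ⟨θ, hθ⟩ := exists_real_map_cos_sq_pi_div hd (K := fieldOf d α)
      (IntermediateField.subset_adjoin ℚ _ (by simp)) σ
  have he : (⟨_, four_sin_sq_mem_fieldOf d α⟩ : fieldOf d α) =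
      4 * (1 - ⟨Real.cos (Real.pi / d) ^ 2, IntermediateField.subset_adjoin ℚ _ (by simp)⟩) := by
    have hs : 4 * Real.sin (Real.pi / d) ^ 2 = 4 * (1 - Real.cos (Real.pi / d) ^ 2) := by
      rw [Real.sin_sq]
    exact Subtype.ext hs
  rw [he, map_mul, map_sub, map_one, map_ofNat, hθ]
  nlinarith [sq_nonneg (Real.cos θ)]

theorem IsAdmissible.finiteDimensional_fieldOf (h : IsAdmissible t d α) (hd : d ≠ 0) :
    FiniteDimensional ℚ (fieldOf d α) := by
  refine IntermediateField.finiteDimensional_adjoin fun x hx => ?_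
  rcases hx with rfl | rfl
  · exact h.integral.tower_top
  · have h1 : IsIntegral ℚ (2 * Real.cos (Real.pi / d)) := (isIntegral_two_mul_cos hd).tower_top
    have h2 := (h1.pow 2).mul (isIntegral_algebraMap (R := ℚ) (A := ℝ) (x := 1 / 4))
    have he : (2 * Real.cos (Real.pi / d)) ^ 2 * algebraMap ℚ ℝ (1 / 4) =
        Real.cos (Real.pi / d) ^ 2 := by
      rw [eq_ratCast]
      push_cast
      ring
    exact he ▸ h2

theorem IsAdmissible.ringHom_eq (h : IsAdmissible t d α) (hd : d ≠ 0)
    {φ : fieldOf d α →+* ℂ} (hφ : φ ≠ Complex.ofRealHom.comp (fieldOf d α).val.toRingHom) :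
    ∃ σ : fieldOf d α →+* ℝ, (∀ x, φ x = σ x) ∧ ∃ x : fieldOf d α, σ x ≠ (x : ℝ) := by
  have hTR := h.isTotallyReal_fieldOf hd
  obtain ⟨σ, hσ⟩ := exists_real_embedding φ
  refine ⟨σ, hσ, ?_⟩
  by_contra hcon
  push Not at hcon
  exact hφ (RingHom.ext fun x => by rw [hσ, hcon]; rfl)

/-- The degree over `ℚ(α)` is the number of complex embeddings fixing `α`. Only the identity does,
since all others send `α > 4` below `4`. -/
theorem IsAdmissible.fieldOf_eq (h : IsAdmissible t d α) (hd : d ≠ 0) :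
    fieldOf d α = ℚ⟮α⟯ := by
  have hfin := h.finiteDimensional_fieldOf hd
  refine le_antisymm ?_ (adjoin_le_fieldOf d α)
  let _ : Algebra ℚ⟮α⟯ (fieldOf d α) :=
    (IntermediateField.inclusion (adjoin_le_fieldOf d α)).toAlgebra
  let _ : Algebra ℚ⟮α⟯ ℂ := (Complex.ofRealHom.comp ℚ⟮α⟯.val.toRingHom).toAlgebra
  have : IsScalarTower ℚ ℚ⟮α⟯ (fieldOf d α) := IsScalarTower.of_algebraMap_eq fun q => rfl
  have : FiniteDimensional ℚ⟮α⟯ (fieldOf d α) := Module.Finite.of_restrictScalars_finite ℚ _ _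
  have hcard := AlgHom.card ℚ⟮α⟯ (fieldOf d α) ℂ
  have hsub : Subsingleton (fieldOf d α →ₐ[ℚ⟮α⟯] ℂ) := by
    have key : ∀ φ : fieldOf d α →ₐ[ℚ⟮α⟯] ℂ,
        φ.toRingHom = Complex.ofRealHom.comp (fieldOf d α).val.toRingHom := by
      intro φ
      by_contra hφ
      obtain ⟨σ, hσ, hne⟩ := h.ringHom_eq hd hφ
      have h4 := h.map_lt_four hd hne
      have h5 := φ.commutes ⟨α, IntermediateField.mem_adjoin_simple_self ℚ α⟩
      have h6 : φ.toRingHom ⟨α, mem_fieldOf d α⟩ = (α : ℂ) := h5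
      rw [hσ] at h6
      have h7 : σ ⟨α, mem_fieldOf d α⟩ = α := Complex.ofReal_injective h6
      linarith [h.lower]
    exact ⟨fun φ ψ => AlgHom.ext fun x =>
      congrArg (fun f : fieldOf d α →+* ℂ => f x) ((key φ).trans (key ψ).symm)⟩
  have h1 : Module.finrank ℚ⟮α⟯ (fieldOf d α) = 1 := by
    have := Fintype.card_le_one_iff_subsingleton.2 hsub
    have := Module.finrank_pos (R := ℚ⟮α⟯) (M := fieldOf d α)
    omega
  intro x hx
  have hbot := Subalgebra.bot_eq_top_of_finrank_eq_one h1
  have : (⟨x, hx⟩ : fieldOf d α) ∈ (⊥ : Subalgebra ℚ⟮α⟯ (fieldOf d α)) := hbot ▸ Algebra.mem_top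
  obtain ⟨y, hy⟩ := Algebra.mem_bot.1 this
  have : (y : ℝ) = x := congrArg Subtype.val hy
  exact this ▸ y.2

end Admissible

/-! ### Norm estimates and the norm of `4 sin²(π/d)` -/

theorem one_le_abs_norm {K : IntermediateField ℚ ℝ} [FiniteDimensional ℚ K] {β : K}
    (hβ : IsIntegral ℤ (β : ℝ)) (hβ0 : β ≠ 0) : (1 : ℝ) ≤ |(Algebra.norm ℚ β : ℝ)| := by
  have h1 : IsIntegral ℤ β := (isIntegral_algebraMap_iff (algebraMap K ℝ).injective).1 hβ
  obtain ⟨z, hz⟩ := IsIntegrallyClosed.isIntegral_iff.1 (Algebra.isIntegral_norm ℚ h1)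
  have h0 := (Algebra.norm_ne_zero_iff (R := ℚ)).2 hβ0
  rw [← hz] at h0 ⊢
  have hz0 : z ≠ 0 := by rintro rfl; simp at h0
  have := Int.one_le_abs hz0
  rw [eq_intCast, Rat.cast_intCast]
  exact_mod_cast this

/-- If an integer `β` is dominated by `w` at all nonidentical embeddings, then the size of `w`
at the identity is controlled by that of `β` and by the norm of `w`. -/
theorem abs_le_abs_mul_norm {K : IntermediateField ℚ ℝ} [FiniteDimensional ℚ K] {β w : K}
    (hβ : IsIntegral ℤ (β : ℝ)) (hβ0 : β ≠ 0)
    (h : ∀ φ : K →+* ℂ, φ ≠ Complex.ofRealHom.comp K.val.toRingHom → ‖φ β‖ ≤ ‖φ w‖) :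
    |(w : ℝ)| ≤ |(β : ℝ)| * |(Algebra.norm ℚ w : ℝ)| := by
  classical
  let φ₀ : K →ₐ[ℚ] ℂ := (Complex.ofRealHom.comp K.val.toRingHom).toRatAlgHom
  have hnorm : ∀ x : K, |(Algebra.norm ℚ x : ℝ)| =
      |(x : ℝ)| * ∏ φ ∈ Finset.univ.erase φ₀, ‖φ x‖ := by
    intro x
    have h1 := congrArg norm (Algebra.norm_eq_prod_embeddings ℚ ℂ x)
    rw [norm_prod, eq_ratCast, ← Complex.ofReal_ratCast, Complex.norm_real, Real.norm_eq_abs,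
      ← Finset.mul_prod_erase _ _ (Finset.mem_univ φ₀)] at h1
    rw [h1]
    congr 1
    change ‖((x : ℝ) : ℂ)‖ = _
    rw [Complex.norm_real, Real.norm_eq_abs]
  have h1 := one_le_abs_norm hβ hβ0
  have hle : ∏ φ ∈ Finset.univ.erase φ₀, ‖φ β‖ ≤ ∏ φ ∈ Finset.univ.erase φ₀, ‖φ w‖ := by
    refine Finset.prod_le_prod (fun φ _ => norm_nonneg _) fun φ hφ => h φ.toRingHom fun heq => ?_
    exact (Finset.mem_erase.1 hφ).1 (AlgHom.ext fun x => RingHom.congr_fun heq x)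
  rw [hnorm] at h1 ⊢
  calc |(w : ℝ)| ≤ |(w : ℝ)| * (|(β : ℝ)| * ∏ φ ∈ Finset.univ.erase φ₀, ‖φ β‖) :=
        le_mul_of_one_le_right (abs_nonneg _) h1
    _ ≤ |(w : ℝ)| * (|(β : ℝ)| * ∏ φ ∈ Finset.univ.erase φ₀, ‖φ w‖) := by gcongr
    _ = _ := by ring

theorem four_sin_sq_mem_cosField (d : ℕ) : 4 * Real.sin (Real.pi / d) ^ 2 ∈ cosField d := by
  have h4 : (4 : ℝ) ∈ cosField d := ofNat_mem _ 4
  rw [Real.sin_sq]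
  exact mul_mem h4 (sub_mem (one_mem _) (IntermediateField.mem_adjoin_simple_self ℚ _))

/-- The element `4 sin² (π / d)` of `𝔽_d`. -/
noncomputable def fourSinSq (d : ℕ) : cosField d := ⟨_, four_sin_sq_mem_cosField d⟩

/-- A primitive `d`-th root of unity. -/
noncomputable def zeta (d : ℕ) : ℂ := Complex.exp (2 * Real.pi * Complex.I / d)

theorem zeta_isPrimitiveRoot {d : ℕ} (hd : d ≠ 0) : IsPrimitiveRoot (zeta d) d :=
  Complex.isPrimitiveRoot_exp d hd

theorem zeta_im_ne_zero {d : ℕ} (hd : 3 ≤ d) : (zeta d).im ≠ 0 := by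
  have h3 : (3 : ℝ) ≤ d := by exact_mod_cast hd
  have he : zeta d = Complex.exp ((2 * Real.pi / d : ℝ) * Complex.I) := by
    rw [zeta]; congr 1; push_cast; ring
  rw [he, Complex.exp_ofReal_mul_I_im]
  refine (Real.sin_pos_of_pos_of_lt_pi (by positivity) ?_).ne'
  rw [div_lt_iff₀ (by linarith)]
  nlinarith [Real.pi_pos]

theorem fourSinSq_coe (d : ℕ) :
    ((4 * Real.sin (Real.pi / d) ^ 2 : ℝ) : ℂ) = 2 - (zeta d + (zeta d)⁻¹) := by
  have h1 : 4 * Real.sin (Real.pi / d) ^ 2 = 2 - 2 * Real.cos (2 * Real.pi / d) := by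
    rw [Real.sin_sq, show 2 * Real.pi / d = 2 * (Real.pi / d) by ring, Real.cos_two_mul]; ring
  rw [h1, zeta, ← Complex.exp_neg]
  push_cast
  rw [Complex.cos]
  ring_nf

theorem cosField_le_comap (d : ℕ) (x : ℝ) (hx : x ∈ cosField d) : (x : ℂ) ∈ ℚ⟮zeta d⟯ := by
  have h : cosField d ≤ ℚ⟮zeta d⟯.comap Complex.ofRealHom.toRatAlgHom := by
    refine IntermediateField.adjoin_simple_le_iff.2 ?_
    change ((Real.cos (Real.pi / d) ^ 2 : ℝ) : ℂ) ∈ ℚ⟮zeta d⟯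
    have h1 : ((Real.cos (Real.pi / d) ^ 2 : ℝ) : ℂ) = (2 + (zeta d + (zeta d)⁻¹)) / 4 := by
      have := fourSinSq_coe d
      rw [Real.sin_sq] at this
      push_cast at this ⊢
      linear_combination - this / 4
    have hz := IntermediateField.mem_adjoin_simple_self ℚ (zeta d)
    rw [h1]
    exact div_mem (add_mem (ofNat_mem _ 2) (add_mem hz (inv_mem hz))) (ofNat_mem _ 4)
  exact h hx

/-- With `g = ζ_d`, the cyclotomic field is quadratic over `𝔽_d`: `g` is a nonreal root of `X² - (2
- s)X + 1`. Moreover `s = (g - 1)(g⁻¹ - 1)`, and both factors have norm `Φ_d(1)`, so the norm of `s`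
from `𝔽_d` has square `Φ_d(1)²`. -/
theorem cosField_finrank_and_norm {d : ℕ} (hd : 3 ≤ d) :
    2 * Module.finrank ℚ (cosField d) = d.totient ∧
      |Algebra.norm ℚ (fourSinSq d)| = (eval 1 (cyclotomic d ℤ) : ℤ) := by
  have : NeZero d := ⟨by omega⟩
  have hζ := zeta_isPrimitiveRoot (NeZero.ne d)
  have hcyc : IsCyclotomicExtension {d} ℚ ℚ⟮zeta d⟯ := by
    have hint : IsIntegral ℚ (zeta d) := (hζ.isIntegral (NeZero.pos d)).tower_top
    change IsCyclotomicExtension {d} ℚ ℚ⟮zeta d⟯.toSubalgebra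
    rw [IntermediateField.adjoin_simple_toSubalgebra_of_isAlgebraic hint.isAlgebraic]
    exact hζ.adjoin_isCyclotomicExtension ℚ
  have hfin : FiniteDimensional ℚ ℚ⟮zeta d⟯ := IsCyclotomicExtension.finiteDimensional {d} ℚ _
  have hirr := cyclotomic.irreducible_rat (NeZero.pos d)
  let f : cosField d →+* ℚ⟮zeta d⟯ :=
    (Complex.ofRealHom.comp (cosField d).val.toRingHom).codRestrict ℚ⟮zeta d⟯.toSubring
      fun x => cosField_le_comap d x x.2
  let _ : Algebra (cosField d) ℚ⟮zeta d⟯ := f.toAlgebra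
  have hcoe : ∀ x : cosField d,
      ((algebraMap (cosField d) ℚ⟮zeta d⟯ x : ℚ⟮zeta d⟯) : ℂ) = ((x : ℝ) : ℂ) := fun x => rfl
  have hst : IsScalarTower ℚ (cosField d) ℚ⟮zeta d⟯ := IsScalarTower.rat
  have hfin' : FiniteDimensional (cosField d) ℚ⟮zeta d⟯ :=
    Module.Finite.of_restrictScalars_finite ℚ _ _
  have hfin'' : FiniteDimensional ℚ (cosField d) := Module.Finite.left ℚ _ ℚ⟮zeta d⟯
  set g : ℚ⟮zeta d⟯ := IntermediateField.AdjoinSimple.gen ℚ (zeta d)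
  have hg : IsPrimitiveRoot g d := IsPrimitiveRoot.coe_submonoidClass_iff.1 hζ
  have hg0 : g ≠ 0 := hg.ne_zero (NeZero.ne d)
  have hs : algebraMap (cosField d) ℚ⟮zeta d⟯ (fourSinSq d) = 2 - (g + g⁻¹) :=
    Subtype.ext ((fourSinSq_coe d).trans rfl)
  have htop : (cosField d)⟮g⟯ = ⊤ := by
    rw [eq_top_iff]
    intro x _
    have h1 : Algebra.adjoin ℚ {g} = ⊤ := IsCyclotomicExtension.adjoin_primitive_root_eq_top hg
    have h2 : Algebra.adjoin ℚ {g} ≤ (cosField d)⟮g⟯.toSubalgebra.restrictScalars ℚ :=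
      Algebra.adjoin_le (Set.singleton_subset_iff.2
        (IntermediateField.mem_adjoin_simple_self (cosField d) g))
    exact h2 (h1 ▸ Algebra.mem_top)
  have hint : IsIntegral (cosField d) g := IsIntegral.of_finite _ _
  have hdeg : Module.finrank (cosField d) ℚ⟮zeta d⟯ = 2 := by
    have hle : Module.finrank (cosField d) ℚ⟮zeta d⟯ ≤ 2 := by
      rw [← IntermediateField.finrank_top', ← htop, IntermediateField.adjoin.finrank hint]
      have hp : (X ^ 2 - C (2 - fourSinSq d) * X + 1 : (cosField d)[X]).natDegree = 2 := by
        compute_degree!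
      rw [← hp]
      refine natDegree_le_of_dvd (minpoly.dvd _ _ ?_) (fun h0 => by rw [h0] at hp; simp at hp)
      simp only [map_add, map_sub, map_mul, map_pow, aeval_X, aeval_C, map_one, hs, map_ofNat]
      field_simp
      ring
    have hne : Module.finrank (cosField d) ℚ⟮zeta d⟯ ≠ 1 := by
      intro h1
      have hbot := Subalgebra.bot_eq_top_of_finrank_eq_one h1
      have hm : g ∈ (⊥ : Subalgebra (cosField d) ℚ⟮zeta d⟯) := hbot ▸ Algebra.mem_top
      obtain ⟨y, hy⟩ := Algebra.mem_bot.1 hm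
      have h2 : (((y : ℝ) : ℂ)) = zeta d := congrArg Subtype.val hy
      apply zeta_im_ne_zero hd
      rw [← h2, Complex.ofReal_im]
    have := Module.finrank_pos (R := cosField d) (M := ℚ⟮zeta d⟯)
    omega
  refine ⟨?_, ?_⟩
  · rw [← IsCyclotomicExtension.finrank ℚ⟮zeta d⟯ hirr,
      ← Module.finrank_mul_finrank ℚ (cosField d) ℚ⟮zeta d⟯, hdeg, mul_comm]
  · have h1 := Algebra.norm_norm (R := ℚ) (S := cosField d)
      (a := algebraMap (cosField d) ℚ⟮zeta d⟯ (fourSinSq d))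
    rw [Algebra.norm_algebraMap, hdeg, map_pow, hs,
      show 2 - (g + g⁻¹) = (g - 1) * (g⁻¹ - 1) by field_simp; ring, map_mul,
      hg.sub_one_norm_eq_eval_cyclotomic (by omega) hirr,
      hg.inv.sub_one_norm_eq_eval_cyclotomic (by omega) hirr, ← sq] at h1
    have h2 := (sq_eq_sq_iff_abs_eq_abs _ _).1 h1
    rw [h2, abs_of_nonneg]
    exact_mod_cast cyclotomic_nonneg d le_rfl

theorem exists_eval_one_cyclotomic {d : ℕ} (hd : 2 ≤ d) :
    ∃ g : ℕ, eval 1 (cyclotomic d ℤ) = g ∧ (g = 1 ∨ g.Prime ∧ g ∣ d ∧ ∃ k, d = g ^ (k + 1)) := by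
  by_cases h : ∃ p k : ℕ, p.Prime ∧ p ^ k = d
  · obtain ⟨p, k, hp, rfl⟩ := h
    have := Fact.mk hp
    rcases k with _ | k
    · simp at hd
    · exact ⟨p, eval_one_cyclotomic_prime_pow k, Or.inr ⟨hp, dvd_pow_self p (by omega), k, rfl⟩⟩
  · push Not at h
    exact ⟨1, by simpa using eval_one_cyclotomic_not_prime_pow (R := ℤ) (n := d) fun hp k => h _ k hp,
      Or.inl rfl⟩

/-! ### Maxima of the auxiliary polynomials -/

/-- In terms of `q = x(s - x)` the left side is `q⁴(s² - 4q)`, which is largest at `q = s²/5`. -/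
theorem quintic_bound {x s : ℝ} (hx : 0 < x) (hxs : x < s) :
    (x ^ 2 * (s - x) ^ 2 * (2 * x - s)) ^ 2 ≤ s ^ 10 / 3125 := by
  have hq : 0 < x * (s - x) := mul_pos hx (by linarith)
  have hs : 0 ≤ s ^ 2 / 5 := by positivity
  set q := x * (s - x) with hqd
  set R := s ^ 2 / 5 with hR
  have h1 : (x ^ 2 * (s - x) ^ 2 * (2 * x - s)) ^ 2 = q ^ 4 * (5 * R - 4 * q) := by
    rw [hqd, hR]; ring
  have h2 : s ^ 10 / 3125 = R ^ 5 := by rw [hR]; ring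
  have h3 : R ^ 5 - q ^ 4 * (5 * R - 4 * q) =
      (R - q) ^ 2 * (R ^ 3 + 2 * R ^ 2 * q + 3 * R * q ^ 2 + 4 * q ^ 3) := by ring
  rw [h1, h2, ← sub_nonneg, h3]
  positivity

/-- This is the parabola `q(q - s + 1)` for `q = x(s - x) ∈ (0, s²/4]`. The two hypotheses are its
value at `q = s²/4` and the modulus of its minimum, at `q = (s - 1)/2`. -/
theorem quartic_bound {x s B : ℝ} (hx : 0 < x) (hxs : x < s) (h1 : (s * (s - 2) / 4) ^ 2 ≤ B)
    (h2 : (s - 1) ^ 2 / 4 ≤ B) : |x * (s - x) * (x * (s - x) - s + 1)| ≤ B := by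
  have hq : 0 < x * (s - x) := mul_pos hx (by linarith)
  have hq' : x * (s - x) ≤ s ^ 2 / 4 := by nlinarith [sq_nonneg (2 * x - s)]
  set q := x * (s - x)
  rw [abs_le]
  constructor
  · nlinarith [sq_nonneg (2 * q - (s - 1))]
  · have hB : 0 ≤ B := (sq_nonneg _).trans h1
    by_cases hc : q - s + 1 ≤ 0
    · nlinarith
    · push Not at hc
      have : q * (q - s + 1) ≤ s ^ 2 / 4 * (s ^ 2 / 4 - s + 1) :=
        mul_le_mul hq' (by linarith) hc.le (by positivity)
      nlinarith

theorem pow_le_exp {t : ℝ} (ht : 0 ≤ t) (n : ℕ) : t ^ n ≤ Real.exp (n * (t - 1)) := by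
  have := Real.add_one_le_exp (t - 1)
  rw [Real.exp_nat_mul]
  exact pow_le_pow_left₀ ht (by linarith) n

/-- Weighted AM-GM with weights `3, 4, 3`, from `t ≤ exp(t - 1)`. -/
theorem prod_pow_le_one {a b c : ℝ} (ha : 0 ≤ a) (hb : 0 ≤ b) (hc : 0 ≤ c)
    (h : 3 * (a - 1) + 4 * (b - 1) + 3 * (c - 1) = 0) : a ^ 3 * b ^ 4 * c ^ 3 ≤ 1 := by
  have h1 := pow_le_exp ha 3
  have h2 := pow_le_exp hb 4
  have h3 := pow_le_exp hc 3
  calc a ^ 3 * b ^ 4 * c ^ 3 ≤ Real.exp ((3 : ℕ) * (a - 1)) * Real.exp ((4 : ℕ) * (b - 1)) *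
        Real.exp ((3 : ℕ) * (c - 1)) := by gcongr
    _ = Real.exp (3 * (a - 1) + 4 * (b - 1) + 3 * (c - 1)) := by
        rw [← Real.exp_add, ← Real.exp_add]; push_cast; rfl
    _ = 1 := by rw [h, Real.exp_zero]

theorem cubic_bound {v : ℝ} (h0 : 0 ≤ v) (h1 : v ≤ 9 / 4) :
    |v ^ 3 * (v - 2) ^ 4 * (v - 1) ^ 3| ≤ 906 / 10000 := by
  rcases le_total v 1 with hv | hv
  · have h := prod_pow_le_one (a := v / (2 / 5)) (b := (2 - v) / (8 / 5)) (c := (1 - v) / (3 / 5))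
      (by positivity) (div_nonneg (by linarith) (by norm_num))
      (div_nonneg (by linarith) (by norm_num)) (by ring)
    have he : v ^ 3 * (v - 2) ^ 4 * (v - 1) ^ 3 = -((2 / 5) ^ 3 * (8 / 5) ^ 4 * (3 / 5) ^ 3 *
      ((v / (2 / 5)) ^ 3 * ((2 - v) / (8 / 5)) ^ 4 * ((1 - v) / (3 / 5)) ^ 3)) := by ring
    have h2v : 0 ≤ 2 - v := by linarith
    have h1v : 0 ≤ 1 - v := by linarith
    rw [he, abs_neg, abs_of_nonneg (by positivity)]
    linarith
  rcases le_total v 2 with hv' | hv'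
  · have h := prod_pow_le_one (a := v / (3 / 2)) (b := (2 - v) / (1 / 2)) (c := (v - 1) / (1 / 2))
      (by positivity) (div_nonneg (by linarith) (by norm_num))
      (div_nonneg (by linarith) (by norm_num)) (by ring)
    have he : v ^ 3 * (v - 2) ^ 4 * (v - 1) ^ 3 = (3 / 2) ^ 3 * (1 / 2) ^ 4 * (1 / 2) ^ 3 *
      ((v / (3 / 2)) ^ 3 * ((2 - v) / (1 / 2)) ^ 4 * ((v - 1) / (1 / 2)) ^ 3) := by ring
    have h2v : 0 ≤ 2 - v := by linarith
    have h1v : 0 ≤ v - 1 := by linarith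
    rw [he, abs_of_nonneg (by positivity)]
    linarith
  · have h2v : 0 ≤ v - 2 := by linarith
    have h1v : 0 ≤ v - 1 := by linarith
    rw [abs_of_nonneg (by positivity)]
    calc v ^ 3 * (v - 2) ^ 4 * (v - 1) ^ 3 ≤
        (9 / 4) ^ 3 * (9 / 4 - 2) ^ 4 * (9 / 4 - 1) ^ 3 := by gcongr
      _ ≤ _ := by norm_num

/-! ### Degree bounds: general `d`, then `d = 3, 4, 5, 7` -/

section Admissible

variable {t : ℝ} {d : ℕ} {α : ℝ}

/-- The generator `α` as an element of its field. -/
noncomputable def gen (d : ℕ) (α : ℝ) : fieldOf d α := ⟨α, mem_fieldOf d α⟩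

/-- The element `4 sin² (π / d)` of `ℚ(α, cos² (π / d))`. -/
noncomputable def sinElt (d : ℕ) (α : ℝ) : fieldOf d α :=
  ⟨4 * Real.sin (Real.pi / d) ^ 2, four_sin_sq_mem_fieldOf d α⟩

theorem IsAdmissible.abs_le_mul_norm (h : IsAdmissible t d α) (hd : d ≠ 0) {β w : fieldOf d α}
    (hβ : IsIntegral ℤ (β : ℝ)) (hβ0 : (β : ℝ) ≠ 0)
    (H : ∀ σ : fieldOf d α →+* ℝ, 0 < σ (gen d α) → σ (gen d α) < σ (sinElt d α) →
      |σ β| ≤ |σ w|) :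
    |(w : ℝ)| ≤ |(β : ℝ)| * |(Algebra.norm ℚ w : ℝ)| := by
  have := h.finiteDimensional_fieldOf hd
  refine abs_le_abs_mul_norm hβ (fun h0 => hβ0 (by rw [h0]; rfl)) fun φ hφ => ?_
  obtain ⟨σ, hσ, hne⟩ := h.ringHom_eq hd hφ
  obtain ⟨h1, h2⟩ := h.conj σ hne
  rw [hσ, hσ, Complex.norm_real, Complex.norm_real]
  exact H σ h1 h2

theorem finrank_fieldOf (d : ℕ) (α : ℝ) :
    Module.finrank ℚ (cosField d) * (cosField d).relfinrank (fieldOf d α) =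
      Module.finrank ℚ (fieldOf d α) :=
  IntermediateField.finrank_bot_mul_relfinrank (cosField_le_fieldOf d α)

theorem finrank_cosField_pos {d : ℕ} (hd : 3 ≤ d) : 0 < Module.finrank ℚ (cosField d) := by
  have h1 := (cosField_finrank_and_norm hd).1
  have h2 : 0 < d.totient := Nat.totient_pos.2 (by omega)
  omega

theorem IsAdmissible.relfinrank_pos (h : IsAdmissible t d α) (hd : 3 ≤ d) :
    0 < (cosField d).relfinrank (fieldOf d α) := by
  have := h.finiteDimensional_fieldOf (by omega)
  have h1 := Module.finrank_pos (R := ℚ) (M := fieldOf d α)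
  rw [← finrank_fieldOf] at h1
  exact Nat.pos_of_mul_pos_left h1

theorem IsAdmissible.norm_sinElt (h : IsAdmissible t d α) (hd : 3 ≤ d) :
    |(Algebra.norm ℚ (sinElt d α) : ℝ)| =
      ((eval 1 (cyclotomic d ℤ) : ℤ) : ℝ) ^ (cosField d).relfinrank (fieldOf d α) := by
  have := h.finiteDimensional_fieldOf (by omega)
  let _ : Algebra (cosField d) (fieldOf d α) :=
    (IntermediateField.inclusion (cosField_le_fieldOf d α)).toAlgebra
  have : IsScalarTower ℚ (cosField d) (fieldOf d α) := IsScalarTower.rat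
  have hm : Module.finrank (cosField d) (fieldOf d α) =
      (cosField d).relfinrank (fieldOf d α) := by
    have h1 := Module.finrank_mul_finrank ℚ (cosField d) (fieldOf d α)
    rw [← finrank_fieldOf] at h1
    exact Nat.eq_of_mul_eq_mul_left (finrank_cosField_pos hd) h1
  have h1 : sinElt d α = algebraMap (cosField d) (fieldOf d α) (fourSinSq d) := rfl
  rw [h1, ← Algebra.norm_norm (R := ℚ) (S := cosField d), Algebra.norm_algebraMap, map_pow, hm,
    Rat.cast_pow, abs_pow]
  congr 1
  exact_mod_cast (cosField_finrank_and_norm hd).2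

theorem norm_ratCast (h : FiniteDimensional ℚ (fieldOf d α)) (q : ℚ) :
    Algebra.norm ℚ (q : fieldOf d α) = q ^ Module.finrank ℚ (fieldOf d α) := by
  have := Algebra.norm_algebraMap (R := ℚ) (S := fieldOf d α) q
  rwa [eq_ratCast] at this

theorem IsAdmissible.isIntegral_sinElt (hd : d ≠ 0) : IsIntegral ℤ (sinElt d α : ℝ) :=
  isIntegral_four_mul_sin_sq hd

/-- The numerical consequence of the quintic auxiliary polynomial. -/
theorem IsAdmissible.generic_bound (h : IsAdmissible 14 d α) (hd : 3 ≤ d) :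
    (4 * Real.sin (Real.pi / d) ^ 2) ^ 10 * 3125 ^ Module.finrank ℚ (fieldOf d α) ≤
      12500 * 196 ^ 10 * ((eval 1 (cyclotomic d ℤ) : ℤ) : ℝ) ^
        (10 * (cosField d).relfinrank (fieldOf d α)) := by
  have hd0 : d ≠ 0 := by omega
  have hfin := h.finiteDimensional_fieldOf hd0
  have hs4 := four_sin_sq_lt_four hd
  have hs0 : 0 ≤ 4 * Real.sin (Real.pi / d) ^ 2 := by positivity
  have hα4 := h.lower
  have hα : α < 196 := by have := h.upper; norm_num at this; exact this
  set s := 4 * Real.sin (Real.pi / d) ^ 2 with hs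
  have hsint : IsIntegral ℤ s := isIntegral_four_mul_sin_sq hd0
  let β : fieldOf d α :=
    (gen d α ^ 2 * (sinElt d α - gen d α) ^ 2 * (2 * gen d α - sinElt d α)) ^ 2
  -- The maximum in `quintic_bound`, read as a field element.
  let w : fieldOf d α := sinElt d α ^ 10 * ((1 / 3125 : ℚ) : fieldOf d α)
  have hσβ : ∀ σ : fieldOf d α →+* ℝ, σ β = (σ (gen d α) ^ 2 *
      (σ (sinElt d α) - σ (gen d α)) ^ 2 * (2 * σ (gen d α) - σ (sinElt d α))) ^ 2 := fun σ => by
    simp only [β, map_pow, map_mul, map_sub, map_ofNat]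
  have hσw : ∀ σ : fieldOf d α →+* ℝ, σ w = σ (sinElt d α) ^ 10 / 3125 := fun σ => by
    simp only [w, map_pow, map_mul, map_ratCast]
    push_cast
    ring
  have hβ : (β : ℝ) = (α ^ 2 * (s - α) ^ 2 * (2 * α - s)) ^ 2 :=
    hσβ (fieldOf d α).val.toRingHom
  have hw : (w : ℝ) = s ^ 10 / 3125 := hσw (fieldOf d α).val.toRingHom
  have key := h.abs_le_mul_norm hd0 (β := β) (w := w) (by
      rw [hβ]
      have h2 : IsIntegral ℤ (2 : ℝ) := isIntegral_algebraMap (R := ℤ) (A := ℝ) (x := 2)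
      exact ((((h.integral.pow 2).mul ((hsint.sub h.integral).pow 2)).mul
        ((h2.mul h.integral).sub hsint)).pow 2)) (by
      rw [hβ]
      have h1 : s - α ≠ 0 := by linarith
      have h2 : 2 * α - s ≠ 0 := by linarith
      have h3 : α ≠ 0 := by linarith
      exact pow_ne_zero _ (mul_ne_zero (mul_ne_zero (pow_ne_zero _ h3) (pow_ne_zero _ h1)) h2)) (by
      intro σ h1 h2
      rw [hσβ, hσw, abs_of_nonneg (sq_nonneg _)]
      exact (quintic_bound h1 h2).trans (le_abs_self _))
  have hnorm : |(Algebra.norm ℚ w : ℝ)| = ((eval 1 (cyclotomic d ℤ) : ℤ) : ℝ) ^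
        (10 * (cosField d).relfinrank (fieldOf d α)) *
        (1 / 3125) ^ Module.finrank ℚ (fieldOf d α) := by
    rw [map_mul, map_pow, norm_ratCast hfin, Rat.cast_mul, Rat.cast_pow, abs_mul, abs_pow,
      h.norm_sinElt hd, ← pow_mul, mul_comm 10, Rat.cast_pow, abs_of_nonneg (a := _ ^ _)]
    · push_cast; rfl
    · positivity
  rw [hnorm, hw, hβ, abs_of_nonneg (by positivity), abs_of_nonneg (by positivity)] at key
  have hb : (α ^ 2 * (s - α) ^ 2 * (2 * α - s)) ^ 2 ≤ 4 * 196 ^ 10 := by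
    have h1 : (s - α) ^ 2 ≤ 196 ^ 2 := by nlinarith
    have h2 : 0 ≤ 2 * α - s := by linarith
    have h3 : 2 * α - s ≤ 392 := by linarith
    have h4 : 0 ≤ α := by linarith
    calc (α ^ 2 * (s - α) ^ 2 * (2 * α - s)) ^ 2 ≤ (196 ^ 2 * 196 ^ 2 * 392) ^ 2 := by gcongr
      _ = _ := by norm_num
  set N := Module.finrank ℚ (fieldOf d α)
  have hE : 0 ≤ ((eval 1 (cyclotomic d ℤ) : ℤ) : ℝ) := by
    exact_mod_cast cyclotomic_nonneg d le_rfl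
  set G := ((eval 1 (cyclotomic d ℤ) : ℤ) : ℝ) ^ (10 * (cosField d).relfinrank (fieldOf d α))
  have hG : 0 ≤ G := by positivity
  have hN : (0 : ℝ) < 3125 ^ N := by positivity
  rw [one_div, inv_pow, ← div_eq_mul_inv] at key
  have k2 : s ^ 10 / 3125 ≤ 4 * 196 ^ 10 * (G / 3125 ^ N) :=
    key.trans (mul_le_mul_of_nonneg_right hb (by positivity))
  rw [← mul_div_assoc, le_div_iff₀ hN] at k2
  linarith

end Admissible

section Admissible

variable {d : ℕ} {α : ℝ}

theorem IsAdmissible.lt_196 (h : IsAdmissible 14 d α) : α < 196 := by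
  have := h.upper
  norm_num at this
  exact this

theorem IsAdmissible.quartic_le (h : IsAdmissible 14 d α) (hd : 3 ≤ d) {w : fieldOf d α} (k : ℕ)
    (H : ∀ σ : fieldOf d α →+* ℝ, ∀ x, 0 < x → x < σ (sinElt d α) →
      |x * (σ (sinElt d α) - x) * (x * (σ (sinElt d α) - x) - σ (sinElt d α) + 1)| ^ k ≤ |σ w|) :
    |(w : ℝ)| ≤ 196 ^ (4 * k) * |(Algebra.norm ℚ w : ℝ)| := by
  have hd0 : d ≠ 0 := by omega
  have hs4 := four_sin_sq_lt_four hd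
  have hs0 : 0 ≤ 4 * Real.sin (Real.pi / d) ^ 2 := by positivity
  have hα4 := h.lower
  have hα := h.lt_196
  have hsint : IsIntegral ℤ (4 * Real.sin (Real.pi / d) ^ 2) := isIntegral_four_mul_sin_sq hd0
  let β : fieldOf d α :=
    (gen d α * (sinElt d α - gen d α) * (gen d α * (sinElt d α - gen d α) - sinElt d α + 1)) ^ k
  have hσβ : ∀ σ : fieldOf d α →+* ℝ, σ β = (σ (gen d α) * (σ (sinElt d α) - σ (gen d α)) *
      (σ (gen d α) * (σ (sinElt d α) - σ (gen d α)) - σ (sinElt d α) + 1)) ^ k := fun σ => by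
    simp only [β, map_pow, map_mul, map_sub, map_add, map_one]
  have hβ := hσβ (fieldOf d α).val.toRingHom
  change (β : ℝ) = (α * (4 * Real.sin (Real.pi / d) ^ 2 - α) *
    (α * (4 * Real.sin (Real.pi / d) ^ 2 - α) - 4 * Real.sin (Real.pi / d) ^ 2 + 1)) ^ k at hβ
  set s := 4 * Real.sin (Real.pi / d) ^ 2
  have key := h.abs_le_mul_norm hd0 (β := β) (w := w) (by
      rw [hβ]
      have h1 := h.integral.mul (hsint.sub h.integral)
      exact (h1.mul ((h1.sub hsint).add isIntegral_one)).pow k) (by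
      rw [hβ]
      have h1 : s - α ≠ 0 := by linarith
      have h2 : α * (s - α) - s + 1 ≠ 0 := by nlinarith
      have h3 : α ≠ 0 := by linarith
      exact pow_ne_zero _ (mul_ne_zero (mul_ne_zero h3 h1) h2)) (by
      intro σ h1 h2
      rw [hσβ, abs_pow]
      exact H σ _ h1 h2)
  refine key.trans (mul_le_mul_of_nonneg_right ?_ (abs_nonneg _))
  rw [hβ, abs_pow, pow_mul]
  refine pow_le_pow_left₀ (abs_nonneg _) ?_ k
  have h1 : 0 ≤ α * (α - s) := by nlinarith
  have h2 : α * (α - s) ≤ 196 ^ 2 := by nlinarith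
  have h3 : 0 ≤ (α - 1) * (α + 1 - s) := by nlinarith
  have h4 : (α - 1) * (α + 1 - s) ≤ 196 ^ 2 := by nlinarith
  -- The quartic is `x(s - x)(x - 1)(s - 1 - x)`; at `x = α > 4 > s` its factors pair up into two
  -- positive products below `196²`.
  have h5 : α * (s - α) * (α * (s - α) - s + 1) =
      (α * (α - s)) * ((α - 1) * (α + 1 - s)) := by ring
  rw [h5, abs_of_nonneg (by positivity)]
  calc _ ≤ (196 : ℝ) ^ 2 * 196 ^ 2 := by gcongr
    _ = _ := by norm_num

theorem four_sin_sq_three : 4 * Real.sin (Real.pi / (3 : ℕ)) ^ 2 = 3 := by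
  push_cast
  rw [Real.sin_pi_div_three, div_pow, Real.sq_sqrt (by norm_num)]
  norm_num

theorem four_sin_sq_four : 4 * Real.sin (Real.pi / (4 : ℕ)) ^ 2 = 2 := by
  push_cast
  rw [Real.sin_pi_div_four, div_pow, Real.sq_sqrt (by norm_num)]
  norm_num

theorem four_sin_sq_five : (4 * Real.sin (Real.pi / (5 : ℕ)) ^ 2) ^ 2 -
    5 * (4 * Real.sin (Real.pi / (5 : ℕ)) ^ 2) + 5 = 0 := by
  push_cast
  have h5 : Real.sqrt 5 ^ 2 = 5 := Real.sq_sqrt (by norm_num)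
  rw [Real.sin_sq, Real.cos_pi_div_five]
  linear_combination (1 / 16 * Real.sqrt 5 ^ 2 + 1 / 4 * Real.sqrt 5 - 1 / 16) * h5

theorem four_sin_sq_seven : (4 * Real.sin (Real.pi / (7 : ℕ)) ^ 2) ^ 3 -
    7 * (4 * Real.sin (Real.pi / (7 : ℕ)) ^ 2) ^ 2 +
    14 * (4 * Real.sin (Real.pi / (7 : ℕ)) ^ 2) - 7 = 0 := by
  have hpos := cos_pi_div_pos (d := 7) (by norm_num)
  push_cast at hpos ⊢
  set x := Real.pi / 7 with hx
  have h43 : Real.cos (2 * (2 * x)) = -Real.cos (3 * x) := by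
    rw [← Real.cos_pi_sub]; congr 1; rw [hx]; ring
  rw [Real.cos_two_mul, Real.cos_two_mul, Real.cos_three_mul] at h43
  rw [Real.sin_sq]
  set c := Real.cos x
  have h0 : (c + 1) * (8 * c ^ 3 - 4 * c ^ 2 - 4 * c + 1) = 0 := by linear_combination h43
  have h1 : 8 * c ^ 3 - 4 * c ^ 2 - 4 * c + 1 = 0 :=
    (mul_eq_zero.1 h0).resolve_left (by linarith)
  linear_combination (-(8 * c ^ 3 + 4 * c ^ 2 - 4 * c - 1)) * h1

theorem sinElt_three : sinElt 3 α = 3 := Subtype.ext four_sin_sq_three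

theorem sinElt_four : sinElt 4 α = 2 := Subtype.ext four_sin_sq_four

theorem sinElt_five : sinElt 5 α ^ 2 - 5 * sinElt 5 α + 5 = 0 := Subtype.ext four_sin_sq_five

theorem sinElt_seven : sinElt 7 α ^ 3 - 7 * sinElt 7 α ^ 2 + 14 * sinElt 7 α - 7 = 0 :=
  Subtype.ext four_sin_sq_seven

theorem IsAdmissible.finrank_le_three (h : IsAdmissible 14 3 α) :
    Module.finrank ℚ (fieldOf 3 α) ≤ 44 := by
  have hfin := h.finiteDimensional_fieldOf (by norm_num)
  have hα4 := h.lower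
  have hα := h.lt_196
  let v : fieldOf 3 α := gen 3 α * (3 - gen 3 α)
  have hσv : ∀ σ : fieldOf 3 α →+* ℝ, σ v = σ (gen 3 α) * (3 - σ (gen 3 α)) := fun σ => by
    simp only [v, map_mul, map_sub, map_ofNat]
  let β : fieldOf 3 α := v ^ 3 * (v - 2) ^ 4 * (v - 1) ^ 3
  have hσβ : ∀ σ : fieldOf 3 α →+* ℝ,
      σ β = σ v ^ 3 * (σ v - 2) ^ 4 * (σ v - 1) ^ 3 := fun σ => by
    simp only [β, map_pow, map_mul, map_sub, map_ofNat, map_one]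
  have hv : (v : ℝ) = α * (3 - α) := hσv (fieldOf 3 α).val.toRingHom
  have hβ : (β : ℝ) = (v : ℝ) ^ 3 * ((v : ℝ) - 2) ^ 4 * ((v : ℝ) - 1) ^ 3 :=
    hσβ (fieldOf 3 α).val.toRingHom
  have hvneg : (v : ℝ) < 0 := by rw [hv]; nlinarith
  have hvint : IsIntegral ℤ (v : ℝ) := by
    rw [hv]
    exact h.integral.mul
      ((isIntegral_algebraMap (R := ℤ) (A := ℝ) (x := 3)).sub h.integral)
  have key := h.abs_le_mul_norm (by norm_num) (β := β) (w := ((906 / 10000 : ℚ) : fieldOf 3 α)) (by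
      rw [hβ]
      have h2 : IsIntegral ℤ (2 : ℝ) := isIntegral_algebraMap (R := ℤ) (A := ℝ) (x := 2)
      exact ((hvint.pow 3).mul ((hvint.sub h2).pow 4)).mul ((hvint.sub isIntegral_one).pow 3)) (by
      rw [hβ]
      have h1 : (v : ℝ) - 2 ≠ 0 := by linarith
      have h2 : (v : ℝ) - 1 ≠ 0 := by linarith
      exact mul_ne_zero (mul_ne_zero (pow_ne_zero _ hvneg.ne) (pow_ne_zero _ h1))
        (pow_ne_zero _ h2)) (by
      intro σ h1 h2
      rw [sinElt_three, map_ofNat] at h2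
      rw [hσβ, map_ratCast]
      refine (cubic_bound ?_ ?_).trans ?_
      · rw [hσv]; nlinarith
      · rw [hσv]; nlinarith [sq_nonneg (2 * σ (gen 3 α) - 3)]
      · push_cast; exact le_abs_self _)
  have hb : |(β : ℝ)| ≤ 37828 ^ 3 * 37830 ^ 4 * 37829 ^ 3 := by
    -- Here `37828 = 196 · 193`, from `v = α(3 - α)` and `α < 196`.
    have hv1 : -37828 ≤ (v : ℝ) := by rw [hv]; nlinarith
    rw [hβ, abs_mul, abs_mul, abs_pow, abs_pow, abs_pow]
    have e1 : |(v : ℝ)| ≤ 37828 := by rw [abs_le]; constructor <;> linarith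
    have e2 : |(v : ℝ) - 2| ≤ 37830 := by rw [abs_le]; constructor <;> linarith
    have e3 : |(v : ℝ) - 1| ≤ 37829 := by rw [abs_le]; constructor <;> linarith
    gcongr
  by_contra hcon
  push Not at hcon
  rw [norm_ratCast hfin, show (((906 / 10000 : ℚ) : fieldOf 3 α) : ℝ) = 906 / 10000 from
    ((map_ratCast (fieldOf 3 α).val.toRingHom _).trans (by push_cast; rfl))] at key
  push_cast at key
  rw [abs_of_nonneg (by norm_num), abs_of_nonneg (a := _ ^ _) (by positivity)] at key
  have h1 : (906 / 10000 : ℝ) ^ Module.finrank ℚ (fieldOf 3 α) ≤ (906 / 10000) ^ 45 :=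
    pow_le_pow_of_le_one (by norm_num) (by norm_num) hcon
  have h2 : (906 / 10000 : ℝ) ≤ 37828 ^ 3 * 37830 ^ 4 * 37829 ^ 3 * (906 / 10000) ^ 45 :=
    key.trans (mul_le_mul hb h1 (by positivity) (by positivity))
  norm_num at h2

theorem IsAdmissible.finrank_le_four (h : IsAdmissible 14 4 α) :
    Module.finrank ℚ (fieldOf 4 α) ≤ 16 := by
  have hfin := h.finiteDimensional_fieldOf (by norm_num)
  -- For `s = 2` the quartic is `q(q - 1)` with `0 < q ≤ 1`, hence at most `1/4` in modulus.
  have key := h.quartic_le (by norm_num) (w := ((1 / 4 : ℚ) : fieldOf 4 α)) 1 (by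
    intro σ x h0 h1
    rw [sinElt_four, map_ofNat] at h1 ⊢
    rw [map_ratCast, pow_one]
    refine (quartic_bound (B := 1 / 4) h0 h1 (by norm_num) (by norm_num)).trans ?_
    push_cast; exact le_abs_self _)
  by_contra hcon
  push Not at hcon
  rw [norm_ratCast hfin, show (((1 / 4 : ℚ) : fieldOf 4 α) : ℝ) = 1 / 4 from
    ((map_ratCast (fieldOf 4 α).val.toRingHom _).trans (by push_cast; rfl))] at key
  push_cast at key
  rw [abs_of_nonneg (by norm_num), abs_of_nonneg (a := _ ^ _) (by positivity)] at key
  have h1 : (1 / 4 : ℝ) ^ Module.finrank ℚ (fieldOf 4 α) ≤ (1 / 4) ^ 17 :=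
    pow_le_pow_of_le_one (by norm_num) (by norm_num) hcon
  have h2 : (1 / 4 : ℝ) ≤ 196 ^ (4 * 1) * (1 / 4) ^ 17 :=
    key.trans (mul_le_mul_of_nonneg_left h1 (by positivity))
  norm_num at h2

theorem abs_norm_eq_one {K : IntermediateField ℚ ℝ} [FiniteDimensional ℚ K] {x y : K}
    (hx : IsIntegral ℤ (x : ℝ)) (hy : IsIntegral ℤ (y : ℝ)) (h : x * y = 1) :
    |(Algebra.norm ℚ x : ℝ)| = 1 := by
  have hx0 : x ≠ 0 := left_ne_zero_of_mul_eq_one h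
  have hy0 : y ≠ 0 := right_ne_zero_of_mul_eq_one h
  have h1 := one_le_abs_norm hx hx0
  have h2 := one_le_abs_norm hy hy0
  have h3 := congrArg (Algebra.norm ℚ) h
  rw [map_mul, map_one] at h3
  have h4 : |(Algebra.norm ℚ x : ℝ)| * |(Algebra.norm ℚ y : ℝ)| = 1 := by
    rw [← abs_mul, ← Rat.cast_mul, h3, Rat.cast_one, abs_one]
  nlinarith

/-- At both roots of `s² - 5s + 5` the endpoint value `(s(s - 2)/4)²` dominates the quartic, so `w`
can be this element. As `(s - 2)(s - 3) = 1`, the factor `s - 2` is a unit and `|N w| = (25/256)^m`.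
-/
theorem IsAdmissible.relfinrank_le_five (h : IsAdmissible 14 5 α) :
    (cosField 5).relfinrank (fieldOf 5 α) ≤ 10 := by
  have hfin := h.finiteDimensional_fieldOf (by norm_num)
  have hroot : ∀ σ : fieldOf 5 α →+* ℝ, σ (sinElt 5 α) ^ 2 - 5 * σ (sinElt 5 α) + 5 = 0 := by
    intro σ
    have := congrArg σ (sinElt_five (α := α))
    simpa only [map_add, map_sub, map_mul, map_pow, map_ofNat, map_zero] using this
  let w : fieldOf 5 α := sinElt 5 α ^ 2 * (sinElt 5 α - 2) ^ 2 * ((1 / 16 : ℚ) : fieldOf 5 α)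
  have hσw : ∀ σ : fieldOf 5 α →+* ℝ, σ w = (σ (sinElt 5 α) * (σ (sinElt 5 α) - 2) / 4) ^ 2 := by
    intro σ
    simp only [w, map_pow, map_mul, map_sub, map_ofNat, map_ratCast]
    push_cast
    ring
  have key := h.quartic_le (by norm_num) (w := w) 1 (by
    intro σ x h0 h1
    rw [hσw, pow_one, abs_of_nonneg (a := _ ^ 2) (sq_nonneg _)]
    refine quartic_bound h0 h1 le_rfl ?_
    have hr := hroot σ
    set s := σ (sinElt 5 α)
    have hs : 4 / 3 ≤ s := by nlinarith
    have e1 : s * (s - 2) = 3 * s - 5 := by linear_combination hr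
    rw [e1]
    nlinarith)
  have hint : ∀ n : ℤ, IsIntegral ℤ ((sinElt 5 α - n : fieldOf 5 α) : ℝ) := fun n => by
    have h1 := (isIntegral_sinElt (d := 5) (α := α) (by norm_num)).sub
      (isIntegral_algebraMap (R := ℤ) (A := ℝ) (x := n))
    simpa using h1
  have hunit : |(Algebra.norm ℚ (sinElt 5 α - 2) : ℝ)| = 1 :=
    abs_norm_eq_one (y := sinElt 5 α - 3) (by simpa using hint 2) (by simpa using hint 3)
      (by linear_combination sinElt_five (α := α))
  have hn : Module.finrank ℚ (cosField 5) = 2 := by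
    have := (cosField_finrank_and_norm (d := 5) (by norm_num)).1
    rw [Nat.totient_prime (by norm_num)] at this
    omega
  have hN := finrank_fieldOf 5 α
  rw [hn] at hN
  have hnorm := h.norm_sinElt (by norm_num)
  have : Fact (Nat.Prime 5) := ⟨by norm_num⟩
  rw [eval_one_cyclotomic_prime] at hnorm
  set m := (cosField 5).relfinrank (fieldOf 5 α)
  have hw : |(Algebra.norm ℚ w : ℝ)| = (25 / 256) ^ m := by
    rw [map_mul, map_mul, map_pow, map_pow, norm_ratCast hfin]
    push_cast
    rw [abs_mul, abs_mul, abs_pow, abs_pow, hunit, hnorm, ← hN, abs_of_nonneg (by positivity),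
      pow_mul (1 / 16 : ℝ), ← pow_mul, mul_comm m, pow_mul, one_pow, mul_one, ← mul_pow]
    norm_num
  rw [hw] at key
  have hw1 : 7 / 160 ≤ |(w : ℝ)| := by
    have e := hσw (fieldOf 5 α).val.toRingHom
    have hr := hroot (fieldOf 5 α).val.toRingHom
    set s := (fieldOf 5 α).val.toRingHom (sinElt 5 α)
    have hs : 138 / 100 ≤ s := by nlinarith
    have e1 : s * (s - 2) = 3 * s - 5 := by linear_combination hr
    change (w : ℝ) = _ at e
    rw [e, e1]
    refine le_trans ?_ (le_abs_self _)
    nlinarith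
  by_contra hcon
  push Not at hcon
  have h1 : (25 / 256 : ℝ) ^ m ≤ (25 / 256) ^ 11 :=
    pow_le_pow_of_le_one (by norm_num) (by norm_num) hcon
  have h2 : (7 / 160 : ℝ) ≤ 196 ^ (4 * 1) * (25 / 256) ^ 11 :=
    (hw1.trans key).trans (mul_le_mul_of_nonneg_left h1 (by positivity))
  norm_num at h2

theorem root_cases {s : ℝ} (h : s ^ 3 - 7 * s ^ 2 + 14 * s - 7 = 0) :
    (753 / 1000 ≤ s ∧ s ≤ 754 / 1000) ∨ (2445 / 1000 ≤ s ∧ s ≤ 2446 / 1000) ∨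
      (3801 / 1000 ≤ s ∧ s ≤ 3802 / 1000) := by
  have h1 : 753 / 1000 ≤ s := by
    by_contra hc
    push Not at hc
    nlinarith [mul_pos (sub_pos.2 hc) (sub_pos.2 hc), sq_nonneg s]
  have h4 : s ≤ 3802 / 1000 := by
    by_contra hc
    push Not at hc
    nlinarith [mul_pos (sub_pos.2 hc) (sub_pos.2 hc),
      mul_pos (mul_pos (sub_pos.2 hc) (sub_pos.2 hc)) (sub_pos.2 hc)]
  rcases le_total s (754 / 1000) with h2 | h2
  · exact Or.inl ⟨h1, h2⟩
  rcases lt_or_ge s (2445 / 1000) with h3 | h3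
  · exfalso
    nlinarith [mul_nonneg (mul_nonneg (sub_nonneg.2 h2) (sub_pos.2 h3).le)
      (by linarith : 0 ≤ 3801 / 1000 - s)]
  rcases le_total s (2446 / 1000) with h5 | h5
  · exact Or.inr (Or.inl ⟨h3, h5⟩)
  rcases lt_or_ge s (3801 / 1000) with h6 | h6
  · exfalso
    nlinarith [mul_nonneg (mul_nonneg (sub_nonneg.2 h5) (sub_pos.2 h6).le)
      (by linarith : 0 ≤ s - 753 / 1000)]
  · exact Or.inr (Or.inr ⟨h6, h4⟩)

/-- At the middle root `s ≈ 2.445` the minimum of the parabola dominates its endpoint value, so the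
choice of `w` made for `d = 5` fails. The exponents `6, 14, 3` and the constant make one expression
in `s` and `s - 2`, a unit, dominate at all three roots. -/
theorem quartic_bound_seven {x s : ℝ} (hx : 0 < x) (hxs : x < s)
    (h : s ^ 3 - 7 * s ^ 2 + 14 * s - 7 = 0) :
    |x * (s - x) * (x * (s - x) - s + 1)| ^ 6 ≤ 9 / 10 ^ 7 * s ^ 14 * |s - 2| ^ 3 := by
  rcases root_cases h with ⟨h1, h2⟩ | ⟨h1, h2⟩ | ⟨h1, h2⟩
  · have h3 : 1246 / 1000 ≤ |s - 2| := by rw [abs_of_neg (by linarith)]; linarith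
    have e1 : 0 ≤ s * (2 - s) / 4 := by nlinarith
    have e2 : s * (2 - s) / 4 ≤ 2349 / 10000 := by nlinarith
    have hb := quartic_bound (B := (2349 / 10000) ^ 2) hx hxs
      (by rw [show s * (s - 2) / 4 = -(s * (2 - s) / 4) by ring, neg_sq]; gcongr)
      (by nlinarith)
    calc _ ≤ ((2349 / 10000 : ℝ) ^ 2) ^ 6 := pow_le_pow_left₀ (abs_nonneg _) hb 6
      _ ≤ 9 / 10 ^ 7 * (753 / 1000) ^ 14 * (1246 / 1000) ^ 3 := by norm_num
      _ ≤ _ := by gcongr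
  · have h3 : 445 / 1000 ≤ |s - 2| := by rw [abs_of_pos (by linarith)]; linarith
    have e1 : 0 ≤ s - 1 := by linarith
    have hb := quartic_bound (B := 5228 / 10000) hx hxs (by
      have e3 : 0 ≤ s * (s - 2) / 4 := by nlinarith
      have e4 : s * (s - 2) / 4 ≤ 1 / 2 := by nlinarith
      nlinarith) (by nlinarith)
    calc _ ≤ (5228 / 10000 : ℝ) ^ 6 := pow_le_pow_left₀ (abs_nonneg _) hb 6
      _ ≤ 9 / 10 ^ 7 * (2445 / 1000) ^ 14 * (445 / 1000) ^ 3 := by norm_num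
      _ ≤ _ := by gcongr
  · have h3 : 1801 / 1000 ≤ |s - 2| := by rw [abs_of_pos (by linarith)]; linarith
    have e1 : 0 ≤ s * (s - 2) / 4 := by nlinarith
    have e2 : s * (s - 2) / 4 ≤ 17129 / 10000 := by nlinarith
    have hb := quartic_bound (B := (17129 / 10000) ^ 2) hx hxs (by gcongr) (by nlinarith)
    calc _ ≤ ((17129 / 10000 : ℝ) ^ 2) ^ 6 := pow_le_pow_left₀ (abs_nonneg _) hb 6
      _ ≤ 9 / 10 ^ 7 * (3801 / 1000) ^ 14 * (1801 / 1000) ^ 3 := by norm_num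
      _ ≤ _ := by gcongr

theorem IsAdmissible.relfinrank_le_seven (h : IsAdmissible 14 7 α) :
    (cosField 7).relfinrank (fieldOf 7 α) ≤ 9 := by
  have hfin := h.finiteDimensional_fieldOf (by norm_num)
  have hroot : ∀ σ : fieldOf 7 α →+* ℝ,
      σ (sinElt 7 α) ^ 3 - 7 * σ (sinElt 7 α) ^ 2 + 14 * σ (sinElt 7 α) - 7 = 0 := by
    intro σ
    have := congrArg σ (sinElt_seven (α := α))
    simpa only [map_add, map_sub, map_mul, map_pow, map_ofNat, map_zero] using this
  let w : fieldOf 7 α := ((9 / 10 ^ 7 : ℚ) : fieldOf 7 α) * sinElt 7 α ^ 14 * (sinElt 7 α - 2) ^ 3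
  have hσw : ∀ σ : fieldOf 7 α →+* ℝ, 0 ≤ σ (sinElt 7 α) →
      |σ w| = 9 / 10 ^ 7 * σ (sinElt 7 α) ^ 14 * |σ (sinElt 7 α) - 2| ^ 3 := by
    intro σ hσ
    simp only [w, map_pow, map_mul, map_sub, map_ofNat, map_ratCast]
    push_cast
    rw [abs_mul, abs_pow, abs_of_nonneg (by positivity)]
  have key := h.quartic_le (by norm_num) (w := w) 6 (by
    intro σ x h0 h1
    rw [hσw σ (h0.trans h1).le]
    exact quartic_bound_seven h0 h1 (hroot σ))
  have hint := isIntegral_sinElt (d := 7) (α := α) (by norm_num)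
  have h2int : IsIntegral ℤ (2 : ℝ) := isIntegral_algebraMap (R := ℤ) (A := ℝ) (x := 2)
  have he : IsIntegral ℤ ((sinElt 7 α - 2 : fieldOf 7 α) : ℝ) := hint.sub h2int
  have hunit : |(Algebra.norm ℚ (sinElt 7 α - 2) : ℝ)| = 1 :=
    abs_norm_eq_one (y := -((sinElt 7 α - 2) ^ 2 - (sinElt 7 α - 2) - 2)) he
      ((((he.pow 2).sub he).sub h2int).neg)
      (by linear_combination -sinElt_seven (α := α))
  have hn : Module.finrank ℚ (cosField 7) = 3 := by
    have := (cosField_finrank_and_norm (d := 7) (by norm_num)).1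
    rw [Nat.totient_prime (by norm_num)] at this
    omega
  have hN := finrank_fieldOf 7 α
  rw [hn] at hN
  have hnorm := h.norm_sinElt (by norm_num)
  have : Fact (Nat.Prime 7) := ⟨by norm_num⟩
  rw [eval_one_cyclotomic_prime] at hnorm
  set m := (cosField 7).relfinrank (fieldOf 7 α)
  have hw : |(Algebra.norm ℚ w : ℝ)| = ((9 / 10 ^ 7) ^ 3 * 7 ^ 14) ^ m := by
    rw [map_mul, map_mul, map_pow, map_pow, norm_ratCast hfin]
    push_cast
    rw [abs_mul, abs_mul, abs_pow, abs_pow, abs_pow, hunit, hnorm, ← hN,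
      abs_of_nonneg (by positivity), one_pow, mul_one, pow_mul, ← pow_mul (_ : ℝ) m, mul_comm m, pow_mul (_ : ℝ) 14, ← mul_pow]
    norm_num
  rw [hw] at key
  have hw1 : 9 / 10 ^ 7 * (753 / 1000 : ℝ) ^ 14 * (1246 / 1000) ^ 3 ≤ |(w : ℝ)| := by
    have hr := hroot (fieldOf 7 α).val.toRingHom
    have e := hσw (fieldOf 7 α).val.toRingHom
    set s := (fieldOf 7 α).val.toRingHom (sinElt 7 α)
    have hs : 0 ≤ s := by rcases root_cases hr with h1 | h1 | h1 <;> linarith [h1.1]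
    have e' : |(w : ℝ)| = _ := e hs
    rw [e']
    rcases root_cases hr with ⟨h1, h2⟩ | ⟨h1, h2⟩ | ⟨h1, h2⟩
    · have h3 : 1246 / 1000 ≤ |s - 2| := le_abs.2 (Or.inr (by linarith))
      gcongr
    · have h3 : 445 / 1000 ≤ |s - 2| := le_abs.2 (Or.inl (by linarith))
      calc _ ≤ 9 / 10 ^ 7 * (2445 / 1000 : ℝ) ^ 14 * (445 / 1000) ^ 3 := by norm_num
        _ ≤ _ := by gcongr
    · have h3 : 1801 / 1000 ≤ |s - 2| := le_abs.2 (Or.inl (by linarith))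
      calc _ ≤ 9 / 10 ^ 7 * (3801 / 1000 : ℝ) ^ 14 * (1801 / 1000) ^ 3 := by norm_num
        _ ≤ _ := by gcongr
  by_contra hcon
  push Not at hcon
  have h1 : ((9 / 10 ^ 7) ^ 3 * 7 ^ 14 : ℝ) ^ m ≤ ((9 / 10 ^ 7) ^ 3 * 7 ^ 14) ^ 10 :=
    pow_le_pow_of_le_one (by norm_num) (by norm_num) hcon
  have h2 := (hw1.trans key).trans (mul_le_mul_of_nonneg_left h1 (by positivity))
  norm_num at h2

end Admissible

/-! ### Lower bounds for the sine and for Euler's function -/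

/-- By concavity the sine lies above its chord from `0` to `π/6`. -/
theorem three_div_le_sin {d : ℕ} (hd : 6 ≤ d) : 3 / (d : ℝ) ≤ Real.sin (Real.pi / d) := by
  have h6 : (6 : ℝ) ≤ d := by exact_mod_cast hd
  have h1 : 6 / (d : ℝ) ≤ 1 := by rw [div_le_one (by linarith)]; exact h6
  have h := strictConcaveOn_sin_Icc.concaveOn.2 (⟨le_rfl, Real.pi_pos.le⟩ : (0 : ℝ) ∈ Set.Icc 0 Real.pi)
    (⟨by positivity, by linarith [Real.pi_pos]⟩ : Real.pi / 6 ∈ Set.Icc 0 Real.pi)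
    (by linarith : 0 ≤ 1 - 6 / (d : ℝ)) (by positivity : 0 ≤ 6 / (d : ℝ)) (by ring)
  simp only [smul_eq_mul, Real.sin_zero, Real.sin_pi_div_six] at h
  have hd0 : (d : ℝ) ≠ 0 := by positivity
  have e : (1 - 6 / (d : ℝ)) * 0 + 6 / d * (Real.pi / 6) = Real.pi / d := by field_simp; ring
  rw [e] at h
  calc 3 / (d : ℝ) = (1 - 6 / (d : ℝ)) * 0 + 6 / d * (1 / 2) := by ring
    _ ≤ _ := h

/-- By multiplicativity this reduces to `p³ ≤ (p - 1)⁴`, which holds for `p ≥ 5`. -/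
theorem totient_pow_four_of_coprime_six (d : ℕ) (h0 : d ≠ 0) (h2 : ¬ 2 ∣ d) (h3 : ¬ 3 ∣ d) :
    d ^ 3 ≤ d.totient ^ 4 := by
  induction d using Nat.recOnPosPrimePosCoprime with
  | zero => exact absurd rfl h0
  | one => simp
  | prime_pow p k hp hk =>
    have hp2 : p ≠ 2 := by rintro rfl; exact h2 (dvd_pow_self 2 hk.ne')
    have hp3 : p ≠ 3 := by rintro rfl; exact h3 (dvd_pow_self 3 hk.ne')
    have hp4 : p ≠ 4 := by rintro rfl; norm_num at hp
    have := hp.two_le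
    obtain ⟨q, rfl⟩ : ∃ q, p = q + 1 := ⟨p - 1, by omega⟩
    have hq : 4 ≤ q := by omega
    obtain ⟨j, rfl⟩ : ∃ j, k = j + 1 := ⟨k - 1, by omega⟩
    rw [Nat.totient_prime_pow_succ hp, Nat.add_sub_cancel]
    have h1 : (q + 1) ^ 3 ≤ q ^ 4 := by nlinarith [pow_pos (by omega : 0 < q) 3, sq_nonneg q]
    calc ((q + 1) ^ (j + 1)) ^ 3 = ((q + 1) ^ j) ^ 3 * (q + 1) ^ 3 := by ring
      _ ≤ ((q + 1) ^ j) ^ 4 * q ^ 4 :=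
          Nat.mul_le_mul (Nat.pow_le_pow_right (by positivity) (by norm_num)) h1
      _ = _ := by ring
  | coprime a b ha hb hab iha ihb =>
    rw [Nat.totient_mul hab, mul_pow, mul_pow]
    exact Nat.mul_le_mul (iha (by omega) (fun h => h2 (h.mul_right b)) fun h => h3 (h.mul_right b))
      (ihb (by omega) (fun h => h2 (h.mul_left a)) fun h => h3 (h.mul_left a))

/-- Only the primes `2` and `3` violate `p³ ≤ (p - 1)⁴`; they cost the factors `8` and `27/16`,
whose product is `27/2`. -/
theorem two_mul_cube_le_totient_pow (d : ℕ) : 2 * d ^ 3 ≤ 27 * d.totient ^ 4 := by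
  rcases eq_or_ne d 0 with rfl | hd
  · simp
  obtain ⟨a, e, he, rfl⟩ := Nat.exists_eq_pow_mul_and_not_dvd hd 2 (by norm_num)
  have he0 : e ≠ 0 := by rintro rfl; simp at he
  obtain ⟨b, f, hf, rfl⟩ := Nat.exists_eq_pow_mul_and_not_dvd he0 3 (by norm_num)
  have hf0 : f ≠ 0 := by rintro rfl; simp at hf
  have hf2 : ¬ 2 ∣ f := fun h => he (h.mul_left _)
  have h1 := totient_pow_four_of_coprime_six f hf0 hf2 hf
  have hc2 : Nat.Coprime (2 ^ a) (3 ^ b * f) :=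
    Nat.Coprime.pow_left _ ((Nat.Prime.coprime_iff_not_dvd Nat.prime_two).2 he)
  have hc3 : Nat.Coprime (3 ^ b) f :=
    Nat.Coprime.pow_left _ ((Nat.Prime.coprime_iff_not_dvd Nat.prime_three).2 hf)
  have ha : (2 ^ a) ^ 3 ≤ 8 * (2 ^ a).totient ^ 4 := by
    rcases a with _ | a
    · simp
    · rw [Nat.totient_prime_pow_succ Nat.prime_two]
      have : 1 ≤ 2 ^ a := Nat.one_le_two_pow
      calc (2 ^ (a + 1)) ^ 3 = 8 * (2 ^ a) ^ 3 := by ring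
        _ ≤ 8 * (2 ^ a) ^ 4 := Nat.mul_le_mul_left _ (Nat.pow_le_pow_right this (by norm_num))
        _ = _ := by norm_num
  have hb : 16 * (3 ^ b) ^ 3 ≤ 27 * (3 ^ b).totient ^ 4 := by
    rcases b with _ | b
    · simp
    · rw [Nat.totient_prime_pow_succ Nat.prime_three]
      have : 1 ≤ 3 ^ b := Nat.one_le_pow _ _ (by norm_num)
      calc 16 * (3 ^ (b + 1)) ^ 3 = 432 * (3 ^ b) ^ 3 := by ring
        _ ≤ 432 * (3 ^ b) ^ 4 := Nat.mul_le_mul_left _ (Nat.pow_le_pow_right this (by norm_num))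
        _ = _ := by norm_num; ring
  rw [Nat.totient_mul hc2, Nat.totient_mul hc3]
  have := Nat.mul_le_mul (Nat.mul_le_mul ha hb) h1
  nlinarith

/-! ### Numerical exclusion of pairs `(d, m)` -/

/-- The numerical inequality excluding relative degrees at least `k`. -/
abbrev Excluded (d n g k : ℕ) : Prop :=
  12500 * 49 ^ 10 * d ^ 20 * g ^ (10 * k) < 9 ^ 10 * 3125 ^ (n * k)

/-- Exclusion at `k` forces `g¹⁰ ≤ 3125ⁿ`, so raising `k` only strengthens the inequality, and every
`m ≥ k` is excluded too. -/
theorem lt_of_excluded {d n g k m : ℕ} (hd : 0 < d) (hg : 0 < g)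
    (h : 9 ^ 10 * 3125 ^ (n * m) ≤ 12500 * 49 ^ 10 * d ^ 20 * g ^ (10 * m))
    (hk : Excluded d n g k) : m < k := by
  by_contra hcon
  push Not at hcon
  obtain ⟨j, rfl⟩ := Nat.exists_eq_add_of_le hcon
  have hd20 : 1 ≤ d ^ 20 := Nat.one_le_pow _ _ hd
  have hGA : g ^ 10 ≤ 3125 ^ n := by
    by_contra hlt
    push Not at hlt
    have h1 : 3125 ^ (n * k) ≤ g ^ (10 * k) := by
      rw [pow_mul, pow_mul]; exact Nat.pow_le_pow_left hlt.le k
    have h2 : 9 ^ 10 ≤ 12500 * 49 ^ 10 * d ^ 20 := by omega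
    exact absurd hk (not_lt.2 (Nat.mul_le_mul h2 h1))
  have h1 : g ^ (10 * j) ≤ 3125 ^ (n * j) := by
    rw [pow_mul, pow_mul]; exact Nat.pow_le_pow_left hGA j
  have h2 : 0 < g ^ (10 * j) := by positivity
  rw [mul_add, mul_add, pow_add, pow_add, ← mul_assoc, ← mul_assoc] at h
  exact absurd (h.trans_lt (Nat.mul_lt_mul_of_pos_right hk h2))
    (not_lt.2 (Nat.mul_le_mul_left _ h1))

theorem growth (n : ℕ) (hn : 27 ≤ n) :
    12500 * 49 ^ 10 * (216 * n ^ 4) ^ 10 < 9 ^ 10 * 3125 ^ n := by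
  induction n, hn using Nat.le_induction with
  | base => norm_num
  | succ n hn ih =>
    -- One step multiplies the left side by at most `(28/27)⁴⁰`, which is below `3125`.
    have h1 : (27 * (n + 1)) ^ 40 ≤ (28 * n) ^ 40 := Nat.pow_le_pow_left (by omega) 40
    have h2 : (n + 1) ^ 40 ≤ 3125 * n ^ 40 := by
      have h3 : 27 ^ 40 * (n + 1) ^ 40 ≤ 27 ^ 40 * (3125 * n ^ 40) := by
        rw [← mul_pow]
        refine h1.trans ?_
        rw [mul_pow, ← mul_assoc]
        exact Nat.mul_le_mul_right _ (by norm_num)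
      exact Nat.le_of_mul_le_mul_left h3 (by norm_num)
    calc 12500 * 49 ^ 10 * (216 * (n + 1) ^ 4) ^ 10
        = 12500 * 49 ^ 10 * 216 ^ 10 * (n + 1) ^ 40 := by ring
      _ ≤ 12500 * 49 ^ 10 * 216 ^ 10 * (3125 * n ^ 40) := Nat.mul_le_mul_left _ h2
      _ = 3125 * (12500 * 49 ^ 10 * (216 * n ^ 4) ^ 10) := by ring
      _ < 3125 * (9 ^ 10 * 3125 ^ n) := Nat.mul_lt_mul_of_pos_left ih (by norm_num)
      _ = _ := by ring

theorem excluded_of_large {d n g : ℕ} (hn : 2 * n = d.totient) (h27 : 27 ≤ n) (hg : g ≤ d) :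
    Excluded d n g 1 := by
  have h1 := two_mul_cube_le_totient_pow d
  rw [← hn] at h1
  have h2 : d ^ 3 ≤ 216 * n ^ 4 := by nlinarith
  rw [Excluded, mul_one, mul_one]
  calc 12500 * 49 ^ 10 * d ^ 20 * g ^ 10 ≤ 12500 * 49 ^ 10 * d ^ 20 * d ^ 10 :=
        Nat.mul_le_mul_left _ (Nat.pow_le_pow_left hg 10)
    _ = 12500 * 49 ^ 10 * (d ^ 3) ^ 10 := by ring
    _ ≤ 12500 * 49 ^ 10 * (216 * n ^ 4) ^ 10 :=
        Nat.mul_le_mul_left _ (Nat.pow_le_pow_left h2 10)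
    _ < _ := growth n h27

/-- Euler's totient function by a direct count, in a form convenient for evaluation. -/
noncomputable def countCoprime (d n : ℕ) : ℕ :=
  Nat.rec (motive := fun _ => ℕ) 0 (fun k c => Nat.add c (Nat.div 1 (Nat.gcd d k))) n

theorem countCoprime_eq (d k : ℕ) :
    countCoprime d k = ((Finset.range k).filter d.Coprime).card := by
  induction k with
  | zero => rfl
  | succ k ih =>
    change countCoprime d k + 1 / Nat.gcd d k = _
    rw [ih, Finset.range_add_one, Finset.filter_insert]
    by_cases h : d.Coprime k
    · have h' : Nat.gcd d k = 1 := h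
      rw [if_pos h, Finset.card_insert_of_notMem (by simp), h']
    · have h' : 1 / Nat.gcd d k = 0 := by
        rw [Nat.div_eq_zero_iff]
        have : Nat.gcd d k ≠ 1 := h
        omega
      rw [if_neg h, h', add_zero]

theorem totient_eq_countCoprime (d : ℕ) : d.totient = countCoprime d d :=
  (countCoprime_eq d d).symm

/-- One more than the bound claimed for the relative degree. -/
def firstExcluded (d : ℕ) : ℕ :=
  -- Outside both lists the value is `1`; `m < 1` is impossible, so such `d` do not occur.
  (boundTable.lookup d).getD (if d ∈ remainingList then 1 else 0) + 1

/-- The numerical verification for a given `d` and a given value at `1` of the cyclotomic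
polynomial. -/
noncomputable def rowCheck (d g : ℕ) : Bool :=
  Nat.blt d 6 || Nat.beq d 7 ||
    Nat.blt (12500 * 49 ^ 10 * d ^ 20 * g ^ (10 * firstExcluded d))
      (9 ^ 10 * 3125 ^ (countCoprime d d / 2 * firstExcluded d))

/-- The numerical verification for a given prime power `d` of `g`. -/
noncomputable def primeCheck (d g : ℕ) : Bool :=
  -- The tests `d ∣ g⁹` and `φ(g) = g - 1` express that `d` is a power of the prime `g`; the
  -- exponent `9` is ample for `d < 105`.
  !Nat.ble 2 g || !Nat.beq (d % g) 0 || !Nat.beq (g ^ 9 % d) 0 ||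
    !Nat.beq (countCoprime g g) (g - 1) || rowCheck d g

/-- The range suffices: if `n ≤ 26` then `φ(d) ≤ 52`, and `2d³ ≤ 27 · 52⁴` gives `d ≤ 462`. The
cases `d < 6` and `d = 7` pass vacuously, being settled by their own polynomials. -/
theorem rowCheck_one : ∀ d < 463, rowCheck d 1 = true := by
  decide +kernel

/-- For prime powers `d ≤ 2φ(d)`, so `φ(d) ≤ 52` gives `d ≤ 104`. -/
theorem primeCheck_all : ∀ d < 105, ∀ g < d + 1, primeCheck d g = true := by
  decide +kernel

theorem firstExcluded_cases {d m : ℕ} (hm : 0 < m) (h : m < firstExcluded d) :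
    (∃ b, (d, b) ∈ boundTable ∧ m ≤ b) ∨ (d ∈ remainingList ∧ m = 1) := by
  rw [firstExcluded] at h
  cases hl : boundTable.lookup d with
  | some b =>
    rw [hl, Option.getD_some] at h
    obtain ⟨l₁, l₂, he, -⟩ := List.lookup_eq_some_iff.1 hl
    exact Or.inl ⟨b, he ▸ by simp, by omega⟩
  | none =>
    rw [hl, Option.getD_none] at h
    split_ifs at h with hr
    · exact Or.inr ⟨hr, by omega⟩
    · omega

/-- The claimed bound for the degree over `ℚ`. -/
def maxDegree (d : ℕ) : ℕ :=
  if d = 3 then 44 else if d = 7 then 27 else if d = 5 ∨ d = 11 then 20 else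
    if d = 13 then 18 else 16

theorem boundTable_degree :
    ∀ p ∈ boundTable, countCoprime p.1 p.1 * p.2 ≤ 2 * maxDegree p.1 := by
  decide +kernel

theorem remainingList_degree : ∀ d ∈ remainingList, countCoprime d d ≤ 2 * maxDegree d := by
  decide +kernel

/-! ### The resulting table of degrees and finiteness -/

section Admissible

variable {d : ℕ} {α : ℝ}

theorem IsAdmissible.generic_bound_nat (h : IsAdmissible 14 d α) (hd : 6 ≤ d) {g : ℕ}
    (hg : eval 1 (cyclotomic d ℤ) = g) :
    9 ^ 10 * 3125 ^ (Module.finrank ℚ (cosField d) * (cosField d).relfinrank (fieldOf d α)) ≤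
      12500 * 49 ^ 10 * d ^ 20 * g ^ (10 * (cosField d).relfinrank (fieldOf d α)) := by
  have h1 := h.generic_bound (by omega)
  rw [hg, ← finrank_fieldOf, Int.cast_natCast] at h1
  have hd0 : (0 : ℝ) < d := by exact_mod_cast (by omega : 0 < d)
  have h2 : 36 / (d : ℝ) ^ 2 ≤ 4 * Real.sin (Real.pi / d) ^ 2 := by
    have h3 := three_div_le_sin hd
    have h4 := pow_le_pow_left₀ (by positivity) h3 2
    rw [div_pow] at h4
    calc 36 / (d : ℝ) ^ 2 = 4 * (3 ^ 2 / (d : ℝ) ^ 2) := by ring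
      _ ≤ _ := by linarith
  set e := Module.finrank ℚ (cosField d) * (cosField d).relfinrank (fieldOf d α)
  set k := 10 * (cosField d).relfinrank (fieldOf d α)
  have h3 : (36 / (d : ℝ) ^ 2) ^ 10 * 3125 ^ e ≤ 12500 * 196 ^ 10 * (g : ℝ) ^ k :=
    (mul_le_mul_of_nonneg_right (pow_le_pow_left₀ (by positivity) h2 10) (by positivity)).trans h1
  rw [div_pow, ← pow_mul, div_mul_eq_mul_div, div_le_iff₀ (by positivity)] at h3
  have h4 : 36 ^ 10 * 3125 ^ e ≤ 12500 * 196 ^ 10 * g ^ k * d ^ 20 := by exact_mod_cast h3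
  have h5 : 4 ^ 10 * (9 ^ 10 * 3125 ^ e) ≤ 4 ^ 10 * (12500 * 49 ^ 10 * d ^ 20 * g ^ k) :=
    calc 4 ^ 10 * (9 ^ 10 * 3125 ^ e) = 36 ^ 10 * 3125 ^ e := by
          rw [← mul_assoc, ← mul_pow, show 4 * 9 = 36 from rfl]
      _ ≤ _ := h4
      _ = _ := by
        rw [show (196 : ℕ) = 4 * 49 by norm_num, mul_pow]; ac_rfl
  exact Nat.le_of_mul_le_mul_left h5 (by norm_num)

theorem excluded_firstExcluded {d n g : ℕ} (hd : 6 ≤ d) (h7 : d ≠ 7)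
    (hn : 2 * n = d.totient) (hg : g = 1 ∨ g.Prime ∧ g ∣ d ∧ ∃ k, d = g ^ (k + 1)) :
    Excluded d n g (firstExcluded d) ∨ Excluded d n g 1 := by
  have hn' : countCoprime d d / 2 = n := by rw [← totient_eq_countCoprime, ← hn]; omega
  have hrow : rowCheck d g = true → Excluded d n g (firstExcluded d) := by
    intro h
    rw [rowCheck, hn', Bool.or_eq_true, Bool.or_eq_true] at h
    rcases h with (h | h) | h
    · exact absurd (Eq.mp Nat.blt_eq h) (by omega)
    · exact absurd (Nat.eq_of_beq_eq_true h) h7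
    · exact Eq.mp Nat.blt_eq h
  have hgd : g ≤ d := by
    rcases hg with rfl | ⟨-, h, -⟩
    · omega
    · exact Nat.le_of_dvd (by omega) h
  by_cases h27 : 27 ≤ n
  · exact Or.inr (excluded_of_large hn h27 hgd)
  -- For `n ≥ 27` growth alone excludes `d`; for `n ≤ 26` only the finitely many checked `d` remain.
  · push Not at h27
    refine Or.inl (hrow ?_)
    rcases hg with rfl | ⟨hp, hgd', k, hk⟩
    · refine rowCheck_one d ?_
      by_contra hc
      push Not at hc
      have h1 := two_mul_cube_le_totient_pow d
      have h2 : 463 ^ 3 ≤ d ^ 3 := Nat.pow_le_pow_left hc 3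
      have h3 : d.totient ^ 4 ≤ 52 ^ 4 := Nat.pow_le_pow_left (by omega) 4
      norm_num at h2 h3
      omega
    · have hg2 := hp.two_le
      have htot : d ≤ 2 * d.totient := by
        rw [hk, Nat.totient_prime_pow_succ hp, pow_succ]
        obtain ⟨q, rfl⟩ : ∃ q, g = q + 2 := ⟨g - 2, by omega⟩
        rw [show q + 2 - 1 = q + 1 by omega]
        calc (q + 2) ^ k * (q + 2) ≤ (q + 2) ^ k * (2 * (q + 1)) :=
              Nat.mul_le_mul_left _ (by omega)
          _ = _ := by ring
      have hd105 : d < 105 := by omega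
      have hk9 : k + 1 ≤ 9 := by
        by_contra hc
        push Not at hc
        have h1 : 2 ^ 9 ≤ 2 ^ (k + 1) := Nat.pow_le_pow_right (by norm_num) hc.le
        have h2 : 2 ^ (k + 1) ≤ g ^ (k + 1) := Nat.pow_le_pow_left hg2 _
        norm_num at h1
        omega
      have h := primeCheck_all d hd105 g (by omega)
      have e1 : Nat.ble 2 g = true := Eq.mpr Nat.ble_eq hg2
      have e2 : d % g = 0 := Nat.mod_eq_zero_of_dvd hgd'
      have e3 : g ^ 9 % d = 0 := Nat.mod_eq_zero_of_dvd (by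
        nth_rewrite 1 [hk]; exact Nat.pow_dvd_pow g hk9)
      have e4 : countCoprime g g = g - 1 := by
        rw [← totient_eq_countCoprime, Nat.totient_prime hp]
      have e5 : ∀ n, Nat.beq n n = true := fun n => Nat.beq_refl n
      rw [primeCheck, e1, e2, e3, e4, e5, e5] at h
      simpa using h

theorem IsAdmissible.relfinrank_lt (h : IsAdmissible 14 d α) (hd : 3 ≤ d) :
    (cosField d).relfinrank (fieldOf d α) < firstExcluded d := by
  have hn1 : ∀ {d : ℕ} {α : ℝ}, 3 ≤ d → d.totient = 2 →
      (cosField d).relfinrank (fieldOf d α) = Module.finrank ℚ (fieldOf d α) := by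
    intro d α hd ht
    have h1 := (cosField_finrank_and_norm hd).1
    have h2 := finrank_fieldOf d α
    rw [show Module.finrank ℚ (cosField d) = 1 by omega, one_mul] at h2
    exact h2
  by_cases h3 : d = 3
  · subst h3
    rw [hn1 le_rfl rfl]
    exact Nat.lt_of_le_of_lt h.finrank_le_three (by decide)
  by_cases h4 : d = 4
  · subst h4
    rw [hn1 hd rfl]
    exact Nat.lt_of_le_of_lt h.finrank_le_four (by decide)
  by_cases h5 : d = 5
  · subst h5
    exact Nat.lt_of_le_of_lt h.relfinrank_le_five (by decide)
  by_cases h7 : d = 7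
  · subst h7
    exact Nat.lt_of_le_of_lt h.relfinrank_le_seven (by decide)
  have hd6 : 6 ≤ d := by omega
  obtain ⟨g, hg, hg'⟩ := exists_eval_one_cyclotomic (d := d) (by omega)
  have hb := h.generic_bound_nat hd6 hg
  have hgpos : 0 < g := by
    rcases hg' with rfl | ⟨hp, -⟩
    · exact one_pos
    · exact hp.pos
  rcases excluded_firstExcluded hd6 h7 (cosField_finrank_and_norm hd).1 hg' with he | he
  · exact lt_of_excluded (by omega) hgpos hb he
  · exact (lt_of_excluded (by omega) hgpos hb he).trans_le (Nat.le_add_left 1 _)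

theorem IsAdmissible.cases (h : IsAdmissible 14 d α) (hd : 3 ≤ d) :
    (∃ b, (d, b) ∈ boundTable ∧ (cosField d).relfinrank (fieldOf d α) ≤ b) ∨
      (d ∈ remainingList ∧ (cosField d).relfinrank (fieldOf d α) = 1) :=
  firstExcluded_cases (h.relfinrank_pos hd) (h.relfinrank_lt hd)

theorem IsAdmissible.finrank_le_maxDegree (h : IsAdmissible 14 d α) (hd : 3 ≤ d) :
    Module.finrank ℚ (fieldOf d α) ≤ maxDegree d := by
  have h1 := (cosField_finrank_and_norm hd).1
  rw [totient_eq_countCoprime] at h1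
  rw [← finrank_fieldOf]
  rcases h.cases hd with ⟨b, hb, hm⟩ | ⟨hr, hm⟩
  · have h2 : countCoprime d d * b ≤ 2 * maxDegree d := boundTable_degree _ hb
    rw [← h1, mul_assoc] at h2
    exact (Nat.mul_le_mul_left _ hm).trans (Nat.le_of_mul_le_mul_left h2 two_pos)
  · have h2 := remainingList_degree _ hr
    rw [← h1] at h2
    rw [hm, mul_one]
    exact Nat.le_of_mul_le_mul_left h2 two_pos

theorem maxDegree_le (d : ℕ) : maxDegree d ≤ 44 := by
  rw [maxDegree]
  split_ifs <;> norm_num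

theorem IsAdmissible.norm_map_gen_le (h : IsAdmissible 14 d α) (hd : d ≠ 0)
    (φ : fieldOf d α →+* ℂ) : ‖φ (gen d α)‖ ≤ 196 := by
  have hα4 := h.lower
  by_cases hφ : φ = Complex.ofRealHom.comp (fieldOf d α).val.toRingHom
  · have : φ (gen d α) = (α : ℂ) := by rw [hφ]; rfl
    rw [this, Complex.norm_real, Real.norm_eq_abs, abs_of_pos (by linarith)]
    exact h.lt_196.le
  · obtain ⟨σ, hσ, hne⟩ := h.ringHom_eq hd hφ
    have h1 := h.map_lt_four hd hne
    have h2 := h.map_pos σ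
    rw [hσ, Complex.norm_real, Real.norm_eq_abs]
    exact (abs_of_pos h2).trans_le (by linarith)

/-- Northcott's argument, for all `d` at once: the minimal polynomials over `ℤ` have degree at most
`44` and bounded coefficients, so there are finitely many of them. -/
theorem finite_admissible : {α : ℝ | ∃ d, 3 ≤ d ∧ IsAdmissible 14 d α}.Finite := by
  classical
  -- A coefficient is at most a power of the root bound `196` times a binomial coefficient, and the
  -- latter is at most `2⁴⁴`.
  let C : ℤ := 196 ^ 44 * 2 ^ 44
  refine (bUnion_roots_finite (algebraMap ℤ ℝ) 44 (Set.finite_Icc (-C) C)).subset ?_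
  rintro α ⟨d, hd, h⟩
  have hd0 : d ≠ 0 := by omega
  have hfin := h.finiteDimensional_fieldOf hd0
  have : NumberField (fieldOf d α) := { }
  have hint : IsIntegral ℤ (gen d α) :=
    (isIntegral_algebraMap_iff (algebraMap (fieldOf d α) ℝ).injective).1 h.integral
  have hdeg := (h.finrank_le_maxDegree hd).trans (maxDegree_le d)
  have hmin := minpoly.isIntegrallyClosed_eq_field_fractions' ℚ hint
  simp_rw [Set.mem_iUnion]
  refine ⟨minpoly ℤ (gen d α), ⟨?_, fun i => ?_⟩, ?_⟩
  · rw [← (minpoly.monic hint).natDegree_map (algebraMap ℤ ℚ), ← hmin]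
    exact (minpoly.natDegree_le _).trans hdeg
  · have h1 := Embeddings.coeff_bdd_of_norm_le (A := ℂ) (h.norm_map_gen_le hd0) i
    rw [hmin, coeff_map, eq_intCast, Int.norm_cast_rat, Int.norm_eq_abs,
      max_eq_left (by norm_num)] at h1
    set N := Module.finrank ℚ (fieldOf d α)
    have h2 : (N.choose (N / 2) : ℝ) ≤ 2 ^ 44 := by
      exact_mod_cast (Nat.choose_le_two_pow N (N / 2)).trans
        (Nat.pow_le_pow_right (by norm_num) hdeg)
    have h3 : (196 : ℝ) ^ N ≤ 196 ^ 44 := pow_le_pow_right₀ (by norm_num) hdeg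
    have h4 : |((minpoly ℤ (gen d α)).coeff i : ℝ)| ≤ 196 ^ 44 * 2 ^ 44 :=
      h1.trans (mul_le_mul h3 h2 (by positivity) (by positivity))
    rw [Set.mem_Icc, ← abs_le]
    exact_mod_cast h4
  · have h1 := congrArg (algebraMap (fieldOf d α) ℝ) (minpoly.aeval ℤ (gen d α))
    rw [map_zero, ← aeval_algebraMap_apply] at h1
    exact mem_rootSet.2 ⟨minpoly.ne_zero hint, h1⟩

end Admissible

theorem groundFieldsΓ₂_finite : (groundFieldsΓ₂ 14).Finite := by
  refine (finite_admissible.image fun α => ℚ⟮α⟯).subset ?_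
  rintro K ⟨d, u, h, rfl⟩
  have hd := h.three_le
  have ha := h.isAdmissible
  refine ⟨u ^ 2, ⟨d, hd, ha⟩, ?_⟩
  rw [groundField_gramΓ₂ hd (by linarith [h.two_lt]), ha.fieldOf_eq (by omega)]

end EdgeGraph

theorem mainTheorem6 :
    -- the two equivalent descriptions of the graphs, with `α = u²`
    (∀ (d : ℕ) (u : ℝ), 3 ≤ d → 0 < u →
      (EdgeGraph.IsΓ₂ 14 d u ↔ EdgeGraph.IsAdmissible 14 d (u ^ 2))) ∧
    -- the possible `d`, and the bounds for `m = [𝕂 : 𝔽_d]` and for `[𝕂 : ℚ]`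
    (∀ (d : ℕ) (u : ℝ), EdgeGraph.IsΓ₂ 14 d u →
      ∀ K : IntermediateField ℚ ℝ, K = EdgeGraph.groundField (EdgeGraph.gramΓ₂ d u) →
        EdgeGraph.cosField d ≤ K ∧
        K = IntermediateField.adjoin ℚ {u ^ 2} ∧
        FiniteDimensional ℚ K ∧
        ((∃ b, (d, b) ∈ EdgeGraph.boundTable ∧
            IntermediateField.relfinrank (EdgeGraph.cosField d) K ≤ b) ∨
          (d ∈ EdgeGraph.remainingList ∧
            IntermediateField.relfinrank (EdgeGraph.cosField d) K = 1 ∧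
            K = EdgeGraph.cosField d)) ∧
        (d = 3 → Module.finrank ℚ K ≤ 44) ∧
        (d = 7 → Module.finrank ℚ K ≤ 27) ∧
        (d = 5 ∨ d = 11 → Module.finrank ℚ K ≤ 20) ∧
        (d = 13 → Module.finrank ℚ K ≤ 18) ∧
        (d ≠ 3 → d ≠ 5 → d ≠ 7 → d ≠ 11 → d ≠ 13 → Module.finrank ℚ K ≤ 16)) ∧
    -- the set of all these ground fields is finite, and their degrees are at most `44`
    (EdgeGraph.groundFieldsΓ₂ 14).Finite ∧
    (∀ K ∈ EdgeGraph.groundFieldsΓ₂ 14, FiniteDimensional ℚ K ∧ Module.finrank ℚ K ≤ 44) := by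
  open EdgeGraph in
  refine ⟨fun d u hd hu => ⟨fun h => h.isAdmissible, fun h => h.isΓ₂ hd hu (by norm_num)⟩, ?_,
    groundFieldsΓ₂_finite, ?_⟩
  · rintro d u h K hK
    have hd := h.three_le
    have ha := h.isAdmissible
    rw [groundField_gramΓ₂ hd (by linarith [h.two_lt])] at hK
    subst hK
    have hdeg := ha.finrank_le_maxDegree hd
    refine ⟨cosField_le_fieldOf d _, ha.fieldOf_eq (by omega),
      ha.finiteDimensional_fieldOf (by omega), ?_, ?_, ?_, ?_, ?_, ?_⟩
    · rcases ha.cases hd with h1 | ⟨h1, h2⟩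
      · exact Or.inl h1
      · exact Or.inr ⟨h1, h2, le_antisymm (IntermediateField.relfinrank_eq_one_iff.1 h2)
          (cosField_le_fieldOf d _)⟩
    · rintro rfl
      exact hdeg
    · rintro rfl
      exact hdeg
    · rintro (rfl | rfl) <;> exact hdeg
    · rintro rfl
      exact hdeg
    · intro h3 h5 h7 h11 h13
      rwa [maxDegree, if_neg h3, if_neg h7, if_neg (not_or.2 ⟨h5, h11⟩), if_neg h13] at hdeg
  · rintro K ⟨d, u, h, rfl⟩
    have hd := h.three_le
    have ha := h.isAdmissible
    rw [groundField_gramΓ₂ hd (by linarith [h.two_lt])]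
    exact ⟨ha.finiteDimensional_fieldOf (by omega),
      (ha.finrank_le_maxDegree hd).trans (maxDegree_le d)⟩
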